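/- **Theorem.** Let $\mathcal H$ be a separable complex Hilbert space, $\mathcal A\subset\mathbb B(\mathcal H)$ a (not necessarily unital) C$^*$-algebra of bounded operators, and $(\mathcal H,F)$ an ungraded even bounded Fredholm module for $\mathcal A$, that is, $F$ is a unitary operator on $\mathcal H$ such that $[F,A]$ is compact for every $A\in\mathcal A$. Let $P\in\mathcal A$ be an orthogonal projection. Then $PFP$, as an operator on $\mathrm{Ran}(P)$, is Fredholm, the spectral flow $\mathrm{SF}(2P-\mathbf 1,F)$ is well-defined, and the even pairing $\langle(\mathcal H,F),[P]_0\rangle_0=\mathrm{Ind}(PFP)$ satisfies $$\langle(\mathcal H,F),[P]_0\rangle_0\;=\;\mathrm{Ind}(PFP)\;=\;-\,\mathrm{SF}(2P-\mathbf 1,F).$$ Here $\mathrm{Ind}(T)=\dim\mathrm{Ker}(T)-\dim\mathrm{Ker}(T^*)$. For a norm continuous path $s\in[0,1]\mapsto F_s$ of bounded self-adjoint Fredholm operators, one chooses a partition $0=s_0<s_1<\dots<s_N=1$ and numbers $-1<a_n<0<b_n<1$ ($n=1,\dots,N$) such that $s\mapsto\chi_{(a_n,b_n]}(F_s)$ is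 norm continuous with constant finite rank on $[s_{n-1},s_n]$, and sets $$\mathrm{SF}(s\in[0,1]\mapsto F_s)=\sum_{n=1}^N\mathrm{Tr}\big(\chi_{(a_n,0]}(F_{s_{n-1}})-\chi_{(a_n,0]}(F_{s_n})\big).$$ For a self-adjoint Fredholm operator $G$ and a unitary $U$, $\Theta(G,U)$ is the set of such paths with $F_0=G$, $F_1=U^*GU$ and $F_s-G$ compact for all $s\in[0,1]$, and $\mathrm{SF}(G,U)$ is the common spectral flow of all paths in $\Theta(G,U)$. That $\mathrm{SF}(2P-\mathbf 1,F)$ is well-defined means: $\Theta(2P-\mathbf 1,F)$ is not empty, each of its paths admits such partitions, and the value of the sum is the same for all these paths and all such partitions. -/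

import Mathlib

namespace SpectralFlowPairing

noncomputable section

/-! ### Fredholm index -/

section Index

variable {E : Type*} [NormedAddCommGroup E] [InnerProductSpace ℂ E] [CompleteSpace E]

/-- The Noether index `dim Ker T - dim Ker T*` of a Fredholm operator `T` on a Hilbert space. -/
def fredholmIndex (T : E →L[ℂ] E) : ℤ :=
  (Module.finrank ℂ T.ker : ℤ) - (Module.finrank ℂ (ContinuousLinearMap.adjoint T).ker : ℤ)

end Index

variable {H : Type*} [NormedAddCommGroup H] [InnerProductSpace ℂ H] [CompleteSpace H]

/-! ### Spectral projections of bounded self-adjoint operators -/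

/-- The spectral projection `χ_{(-∞, c]}(T)` of a bounded self-adjoint operator `T`: the orthogonal
projection onto the kernel of the positive part `(T - c)₊`, where `(T - c)₊ = f(T)` is the continuous
functional calculus of `f(x) = max (x - c) 0`, a function whose zero set is exactly `(-∞, c]`. -/
def spectralProjIic (T : H →L[ℂ] H) (c : ℝ) : H →L[ℂ] H :=
  (cfc (fun x : ℝ => max (x - c) 0) T : H →L[ℂ] H).ker.starProjection

/-- The spectral projection `χ_{(a, b]}(T)` for `a ≤ b`. -/
def spectralProjIoc (T : H →L[ℂ] H) (a b : ℝ) : H →L[ℂ] H :=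
  spectralProjIic T b - spectralProjIic T a

/-- The rank of an operator with finite dimensional range; for a finite rank projection this is
its trace. -/
def rk (Q : H →L[ℂ] H) : ℕ := Module.finrank ℂ Q.range

/-! ### Spectral flow of paths of self-adjoint Fredholm operators -/

/-- A norm continuous path `s ∈ [0, 1] ↦ γ s` of self-adjoint Fredholm operators (values of `γ`
outside `[0, 1]` are irrelevant). -/
structure IsSelfAdjointFredholmPath (γ : ℝ → (H →L[ℂ] H)) : Prop where
  continuousOn : ContinuousOn γ (Set.Icc 0 1)
  selfAdjoint : ∀ s ∈ Set.Icc (0 : ℝ) 1, IsSelfAdjoint (γ s)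
  fredholm : ∀ s ∈ Set.Icc (0 : ℝ) 1, (γ s).IsFredholm

/-- The choices entering the definition of the spectral flow: a partition
`0 = s 0 < s 1 < ... < s N = 1` and numbers `-1 < a n < 0 < b n < 1`, one pair for each interval
`[s n, s (n + 1)]`, `n < N`, on which `χ_{(a n, b n]}(γ t)` is norm continuous in `t` and of constant
finite rank. -/
structure FlowPartition (γ : ℝ → (H →L[ℂ] H)) where
  N : ℕ
  s : ℕ → ℝ
  a : ℕ → ℝ
  b : ℕ → ℝ
  s_zero : s 0 = 0
  s_last : s N = 1
  s_lt : ∀ n < N, s n < s (n + 1)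
  a_mem : ∀ n < N, a n ∈ Set.Ioo (-1 : ℝ) 0
  b_mem : ∀ n < N, b n ∈ Set.Ioo (0 : ℝ) 1
  continuousOn : ∀ n < N,
    ContinuousOn (fun t => spectralProjIoc (γ t) (a n) (b n)) (Set.Icc (s n) (s (n + 1)))
  finite_rank : ∀ n < N, ∀ t ∈ Set.Icc (s n) (s (n + 1)),
    FiniteDimensional ℂ (spectralProjIoc (γ t) (a n) (b n)).range
  rank_const : ∀ n < N, ∀ t ∈ Set.Icc (s n) (s (n + 1)), ∀ t' ∈ Set.Icc (s n) (s (n + 1)),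
    rk (spectralProjIoc (γ t) (a n) (b n)) = rk (spectralProjIoc (γ t') (a n) (b n))

/-- `∑ₙ Tr (χ_{(a n, 0]}(γ (s n)) - χ_{(a n, 0]}(γ (s (n + 1))))`, the trace of a finite rank
projection being its rank. -/
def FlowPartition.flow {γ : ℝ → (H →L[ℂ] H)} (D : FlowPartition γ) : ℤ :=
  ∑ n ∈ Finset.range D.N,
    ((rk (spectralProjIoc (γ (D.s n)) (D.a n) 0) : ℤ)
      - (rk (spectralProjIoc (γ (D.s (n + 1))) (D.a n) 0) : ℤ))

/-- The path `γ` of self-adjoint Fredholm operators has a well-defined spectral flow, equal to `m`: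
suitable partitions exist and all of them give the value `m`. -/
structure HasSpectralFlow (γ : ℝ → (H →L[ℂ] H)) (m : ℤ) : Prop where
  path : IsSelfAdjointFredholmPath γ
  exists_partition : Nonempty (FlowPartition γ)
  flow_eq : ∀ D : FlowPartition γ, D.flow = m

/-! ### Spectral flow of a pair -/

/-- The set `Θ(F, U)` of paths of self-adjoint Fredholm operators from `F` to `U* F U` which are
compact perturbations of `F`. -/
def Theta (F U : H →L[ℂ] H) : Set (ℝ → (H →L[ℂ] H)) :=
  {γ | IsSelfAdjointFredholmPath γ ∧ γ 0 = F ∧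
    (∀ s ∈ Set.Icc (0 : ℝ) 1, IsCompactOperator (γ s - F)) ∧ γ 1 = star U * F * U}

/-- The pair `(F, U)` has a well-defined spectral flow, equal to `m`: there are paths in `Θ(F, U)`,
and all of them have a well-defined spectral flow, equal to `m`. -/
def HasPairSpectralFlow (F U : H →L[ℂ] H) (m : ℤ) : Prop :=
  (Theta F U).Nonempty ∧ ∀ γ ∈ Theta F U, HasSpectralFlow γ m

/-- The spectral flow `SF(F, U)`, the common spectral flow of all paths in `Θ(F, U)` (an arbitrary
integer if this is not well-defined). -/
def pairSpectralFlow (F U : H →L[ℂ] H) : ℤ :=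
  Classical.epsilon (HasPairSpectralFlow F U)

/-! ### Fredholm modules and the even pairing -/

/-- `(H, F)` is an (ungraded) even bounded Fredholm module for the algebra `A` of operators on `H`:
`F` is unitary and `[F, a]` is compact for all `a ∈ A`. -/
structure IsEvenFredholmModule (A : NonUnitalStarSubalgebra ℂ (H →L[ℂ] H)) (F : H →L[ℂ] H) :
    Prop where
  unitary : F ∈ unitary (H →L[ℂ] H)
  compact_commutator : ∀ a ∈ A, IsCompactOperator (F * a - a * F)

/-- `P F P` as an operator on `Ran P`. -/
def compression (P F : H →L[ℂ] H) : P.range →L[ℂ] P.range :=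
  ((P * F * P) ∘L P.range.subtypeL).codRestrict P.range (fun x => ⟨F (P x), rfl⟩)

lemma completeSpace_range {P : H →L[ℂ] H} (hP : IsStarProjection P) : CompleteSpace P.range :=
  (ContinuousLinearMap.IsIdempotentElem.isClosed_range hP.isIdempotentElem).completeSpace_coe

/-- The even pairing `Ind (P F P)` of the even Fredholm module `(H, F)` with (the class of) the
projection `P`, the index being that of `P F P` as an operator on `Ran P`. -/
def evenPairing (F : H →L[ℂ] H) {P : H →L[ℂ] H} (hP : IsStarProjection P) : ℤ :=
  haveI : CompleteSpace P.range := completeSpace_range hP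
  fredholmIndex (compression P F)

end

end SpectralFlowPairing

/-! Both sides are relative indices of the same pair of projections. If `Q - R` is compact, the
operator R : Ran Q → Ran R (`cut`) is Fredholm, and its index `relativeIndex Q R` plays the role of
dim Q - dim R. It is additive (`relativeIndex_trans`), because the index is multiplicative and
insensitive to compact perturbations. It vanishes when ‖Q - R‖ < 1, hence along norm continuous
paths of projections with compact differences, and for R ≤ Q it is the rank of Q - R.

Pairing: since P F = F (F* P F), the compression is `cut P (star F * P * F)` followed by the
isomorphism F : Ran(F* P F) → Ran P. So Ind(PFP) is the relative index of P and F* P F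
(`evenPairing_eq_relativeIndex`).

Flow: along a path in Θ every operator is a compact perturbation of 2P - 1, so no point of (-1, 1)
is an accumulation point of its spectrum (`isolatedIn_spectrum`), and the projections E_c =
χ_{(c,∞)} with c in (-1, 1) differ from P by compacts. On each partition interval E_a is norm
continuous (`continuousOn_spectralProjIoi`), so the summand there is the relative index of E_0 at
the two ends. The sum telescopes to the relative index of F* P F and P (`flow_eq_relativeIndex`),
whatever the path and the partition. Antisymmetry gives the minus sign. -/

namespace SpectralFlowPairing

noncomputable section

/-! ### The index of a linear map -/

section LinearIndex

open LinearMap Submodule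
open scoped LinearMap.FiniteRangeSetoid

variable {K U V W : Type*} [Field K] [AddCommGroup U] [Module K U] [AddCommGroup V] [Module K V]
  [AddCommGroup W] [Module K W]

/-- The index `dim Ker f - dim Coker f` of a linear map. -/
def linearIndex (f : V →ₗ[K] W) : ℤ :=
  (Module.finrank K (ker f) : ℤ) - (Module.finrank K (W ⧸ range f) : ℤ)

/-- A linear map is algebraically Fredholm if its kernel and cokernel are finite dimensional. -/
structure FiniteKerCoker (f : V →ₗ[K] W) : Prop where
  finite_ker : Module.Finite K (ker f)
  finite_coker : Module.Finite K (W ⧸ range f)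

/-- The alternating sum of the dimensions in the six term exact sequence of kernels and cokernels
of a composition. -/
theorem linearIndex_comp {g : V →ₗ[K] W} {f : U →ₗ[K] V} (hg : FiniteKerCoker g)
    (hf : FiniteKerCoker f) : linearIndex (g ∘ₗ f) = linearIndex g + linearIndex f := by
  have := hg.finite_ker
  have := hg.finite_coker
  have := hf.finite_ker
  have := hf.finite_coker
  -- The maps `p`, `q`, `r`, `s` are the arrows ker gf → ker g → coker f → coker gf → coker g.
  -- Exactness is `hp`, `hq`, `hr`, `hs`, `hs'`; rank-nullity for the four arrows then gives the
  -- alternating sum.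
  let p : ker (g ∘ₗ f) →ₗ[K] ker g := f.restrict fun x hx => by simpa using hx
  let q : ker g →ₗ[K] V ⧸ range f := (range f).mkQ ∘ₗ (ker g).subtype
  have hle : range f ≤ (range (g ∘ₗ f)).comap g := by
    rintro _ ⟨x, rfl⟩
    exact ⟨x, rfl⟩
  let r : (V ⧸ range f) →ₗ[K] W ⧸ range (g ∘ₗ f) := mapQ _ _ g hle
  have hle' : range (g ∘ₗ f) ≤ range g := range_comp_le_range f g
  let s : (W ⧸ range (g ∘ₗ f)) →ₗ[K] W ⧸ range g := mapQ _ _ LinearMap.id hle'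
  have hp : ker p ≃ₗ[K] ker f :=
    { toFun := fun x => ⟨x.1.1, congrArg Subtype.val (mem_ker.mp x.2)⟩
      invFun := fun x => ⟨⟨x.1, by simp [show f x.1 = 0 from x.2]⟩, by
        simp only [p, mem_ker, Subtype.ext_iff]; exact x.2⟩
      left_inv := fun _ => rfl
      right_inv := fun _ => rfl
      map_add' := fun _ _ => rfl
      map_smul' := fun _ _ => rfl }
  have hq : ker q = range p := by
    ext ⟨x, hx⟩
    simp only [q, p, mem_ker, LinearMap.comp_apply, Submodule.mkQ_apply,
      Submodule.Quotient.mk_eq_zero, Submodule.subtype_apply, mem_range]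
    constructor
    · rintro ⟨y, rfl⟩
      exact ⟨⟨y, hx⟩, rfl⟩
    · rintro ⟨y, hy⟩
      exact ⟨y.1, congrArg Subtype.val hy⟩
  have hr : ker r = range q := by
    ext x
    obtain ⟨x, rfl⟩ := Submodule.mkQ_surjective _ x
    simp only [r, q, mem_ker, Submodule.mkQ_apply, Submodule.mapQ_apply,
      Submodule.Quotient.mk_eq_zero, mem_range, LinearMap.comp_apply, Submodule.subtype_apply]
    constructor
    · rintro ⟨y, hy⟩
      refine ⟨⟨x - f y, by simp [← hy]⟩, ?_⟩
      rw [Submodule.Quotient.eq]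
      exact ⟨-y, by simp⟩
    · rintro ⟨y, hy⟩
      rw [Submodule.Quotient.eq] at hy
      obtain ⟨z, hz⟩ := hy
      refine ⟨-z, ?_⟩
      simp [hz, show g y.1 = 0 from y.2]
  have hs : ker s = range r := by
    ext x
    obtain ⟨x, rfl⟩ := Submodule.mkQ_surjective _ x
    simp only [s, r, mem_ker, Submodule.mkQ_apply, Submodule.mapQ_apply,
      LinearMap.id_apply, Submodule.Quotient.mk_eq_zero, mem_range]
    constructor
    · rintro ⟨y, rfl⟩
      exact ⟨Submodule.Quotient.mk y, by simp⟩
    · rintro ⟨y, hy⟩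
      obtain ⟨y, rfl⟩ := Submodule.mkQ_surjective _ y
      simp only [Submodule.mkQ_apply, Submodule.mapQ_apply] at hy
      rw [Submodule.Quotient.eq] at hy
      obtain ⟨z, hz⟩ := hle' hy
      exact ⟨y - z, by simp [hz]⟩
  have hs' : range s = ⊤ := by simp [s, range_mapQ]
  have : Module.Finite K (ker p) := Module.Finite.equiv hp.symm
  have : Module.Finite K (ker (g ∘ₗ f)) :=
    have := Module.Finite.equiv p.quotKerEquivRange.symm
    Module.Finite.of_submodule_quotient (ker p)
  have : Module.Finite K (ker s) := by rw [hs]; infer_instance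
  have : Module.Finite K (W ⧸ range (g ∘ₗ f)) :=
    have := Module.Finite.equiv s.quotKerEquivRange.symm
    Module.Finite.of_submodule_quotient (ker s)
  have ep := p.finrank_range_add_finrank_ker
  have eq := q.finrank_range_add_finrank_ker
  have er := r.finrank_range_add_finrank_ker
  have es := s.finrank_range_add_finrank_ker
  rw [hp.finrank_eq] at ep
  rw [hq] at eq
  rw [hr] at er
  rw [hs, hs', finrank_top] at es
  unfold linearIndex
  omega

theorem linearIndex_of_bijective {f : V →ₗ[K] W} (h : Function.Bijective f) :
    linearIndex f = 0 := by
  rw [linearIndex, ker_eq_bot.mpr h.1, range_eq_top.mpr h.2, finrank_bot,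
    Module.finrank_zero_of_subsingleton, sub_self]

theorem FiniteKerCoker.of_bijective {f : V →ₗ[K] W} (h : Function.Bijective f) :
    FiniteKerCoker f := by
  refine ⟨?_, ?_⟩
  · rw [ker_eq_bot.mpr h.1]; infer_instance
  · rw [range_eq_top.mpr h.2]; infer_instance

/-- The index is invariant under finite rank perturbations. -/
theorem linearIndex_congr {f g : V →ₗ[K] W} (hf : FiniteKerCoker f) (hg : FiniteKerCoker g)
    (h : f ≈ g) : linearIndex f = linearIndex g := by
  -- The two maps agree on a subspace of finite codimension; composing both with its inclusion,
  -- which has finite kernel and cokernel, gives equal indices, and the index of the inclusion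
  -- cancels.
  have hN := FiniteRangeSetoid.equiv_iff_eqLocus_coFG.mp h
  have hι : FiniteKerCoker (eqLocus f g).subtype := by
    refine ⟨?_, ?_⟩
    · rw [ker_subtype]; infer_instance
    · rw [range_subtype]; exact hN
  have hfg : f ∘ₗ (eqLocus f g).subtype = g ∘ₗ (eqLocus f g).subtype := by
    ext ⟨x, hx⟩
    exact hx
  have h1 := linearIndex_comp hf hι
  rw [hfg, linearIndex_comp hg hι] at h1
  exact (add_right_cancel h1).symm

end LinearIndex

/-! ### Compact perturbations on Hilbert spaces -/

section Parametrix

set_option linter.unusedSectionVars false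

open LinearMap.FiniteRangeSetoid

variable {X Y : Type*} [NormedAddCommGroup X] [InnerProductSpace ℂ X] [CompleteSpace X]
  [NormedAddCommGroup Y] [InnerProductSpace ℂ Y] [CompleteSpace Y]

theorem finiteKerCoker_of_isFredholm {A : X →L[ℂ] Y} (hA : A.IsFredholm) :
    FiniteKerCoker A.toLinearMap :=
  ⟨hA.finite_ker, hA.finite_coker⟩

/-- Compact operators into a Hilbert space are limits of finite rank operators. -/
theorem exists_hasFiniteRange_norm_sub_lt {K : X →L[ℂ] Y} (hK : IsCompactOperator K) {ε : ℝ}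
    (hε : 0 < ε) : ∃ R : X →L[ℂ] Y, R.toLinearMap.HasFiniteRange ∧ ‖K - R‖ < ε := by
  obtain ⟨C, hC, hKC⟩ := hK.image_closedBall_subset_compact (𝕜₁ := ℂ) 1
  obtain ⟨t, ht, hCt⟩ := Metric.totallyBounded_iff.mp hC.totallyBounded (ε / 2) (half_pos hε)
  -- The approximant is `K` followed by projection onto the span of a finite ε/2-net for the image
  -- of the unit ball; the projection is at least as close to `K x` as the nearby net point.
  let S : Submodule ℂ Y := Submodule.span ℂ t
  have this' : FiniteDimensional ℂ S := FiniteDimensional.span_of_finite ℂ ht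
  refine ⟨S.starProjection ∘L K, ?_, ?_⟩
  · refine LinearMap.HasFiniteRange.comp_right (v := S.starProjection.toLinearMap) ?_ _
    have : S.starProjection.toLinearMap.range = S := by simp
    rw [LinearMap.HasFiniteRange, this]
    exact S.fg_iff_finiteDimensional.mpr this'
  · refine lt_of_le_of_lt ?_ (half_lt_self hε)
    refine ContinuousLinearMap.opNorm_le_of_unit_norm (half_pos hε).le fun x hx => ?_
    obtain ⟨y, hy, hxy⟩ := Set.mem_iUnion₂.mp (hCt (hKC ⟨x, by simp [hx], rfl⟩))
    have h1 : ‖K x - S.starProjection (K x)‖ ≤ ‖K x - y‖ := by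
      rw [Submodule.starProjection_minimal]
      exact ciInf_le ⟨0, by rintro _ ⟨z, rfl⟩; positivity⟩
        (⟨y, Submodule.subset_span hy⟩ : S)
    exact h1.trans (by rw [← dist_eq_norm]; exact (Metric.mem_ball.mp hxy).le)

/-- An operator differing from the identity by a compact operator is, up to finite rank, an
invertible operator. -/
theorem exists_continuousLinearEquiv_equiv {T : X →L[ℂ] X}
    (hT : IsCompactOperator (T - ContinuousLinearMap.id ℂ X)) :
    ∃ e : X ≃L[ℂ] X, T.toLinearMap ≈ e.toLinearEquiv.toLinearMap := by
  obtain ⟨R, hR, hlt⟩ := exists_hasFiniteRange_norm_sub_lt hT one_pos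
  have hu : IsUnit (T - R) := by
    have h := isUnit_one_sub_of_norm_lt_one (x := -(T - ContinuousLinearMap.id ℂ X - R))
      (by rwa [norm_neg])
    have h' : T - R = 1 - -(T - ContinuousLinearMap.id ℂ X - R) := by
      rw [ContinuousLinearMap.one_def]
      abel
    rwa [h']
  obtain ⟨u, hu⟩ := hu
  refine ⟨ContinuousLinearEquiv.ofUnit u, ?_⟩
  rw [equiv_iff_hasFiniteRange]
  have h : T.toLinearMap - (ContinuousLinearEquiv.ofUnit u).toLinearEquiv.toLinearMap
      = R.toLinearMap := by
    ext x
    have : (u : X →L[ℂ] X) x = T x - R x := by rw [hu]; rfl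
    change T x - (u : X →L[ℂ] X) x = R x
    rw [this, sub_sub_cancel]
  rwa [h]

/-- `A` and `B` are inverse to each other up to compact operators. -/
structure IsParametrix (B : Y →L[ℂ] X) (A : X →L[ℂ] Y) : Prop where
  left : IsCompactOperator (B ∘L A - ContinuousLinearMap.id ℂ X)
  right : IsCompactOperator (A ∘L B - ContinuousLinearMap.id ℂ Y)

theorem IsParametrix.symm {B : Y →L[ℂ] X} {A : X →L[ℂ] Y} (h : IsParametrix B A) :
    IsParametrix A B :=
  ⟨h.right, h.left⟩

/-- Correcting `B` by the invertible operators `e` and `e'` yields a left inverse `v` and a right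
inverse `w` modulo finite rank. As usual for one-sided inverses, they agree modulo finite rank, so
`v` is a two-sided quasi-inverse. -/
theorem IsParametrix.isFredholm {B : Y →L[ℂ] X} {A : X →L[ℂ] Y} (h : IsParametrix B A) :
    A.IsFredholm := by
  obtain ⟨e, he⟩ := exists_continuousLinearEquiv_equiv h.left
  obtain ⟨e', he'⟩ := exists_continuousLinearEquiv_equiv h.right
  let v : Y →L[ℂ] X := (e.symm : X →L[ℂ] X) ∘L B
  let w : Y →L[ℂ] X := B ∘L (e'.symm : Y →L[ℂ] Y)
  have hv : v.toLinearMap ∘ₗ A.toLinearMap ≈ LinearMap.id := by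
    have h1 := equiv_comp_left (u' := e.symm.toLinearEquiv.toLinearMap) he
    have h2 : e.symm.toLinearEquiv.toLinearMap ∘ₗ e.toLinearEquiv.toLinearMap = LinearMap.id := by
      ext x
      simp
    rwa [h2] at h1
  have hw : A.toLinearMap ∘ₗ w.toLinearMap ≈ LinearMap.id := by
    have h1 := equiv_comp_right (u := e'.symm.toLinearEquiv.toLinearMap) he'
    have h2 : e'.toLinearEquiv.toLinearMap ∘ₗ e'.symm.toLinearEquiv.toLinearMap
        = LinearMap.id := by
      ext x
      simp
    rwa [h2] at h1
  have hvw : v.toLinearMap ≈ w.toLinearMap := by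
    have h1 := equiv_comp_left (u' := v.toLinearMap) hw
    have h2 := equiv_comp_right (u := w.toLinearMap) hv
    exact Setoid.trans (Setoid.symm h1) h2
  exact ContinuousLinearMap.IsFredholm.of_isQuasiInverse (v := v)
    ⟨hv, Setoid.trans (equiv_comp_left (u' := A.toLinearMap) hvw) hw⟩

theorem linearIndex_eq_zero_of_sub_id {T : X →L[ℂ] X}
    (hT : IsCompactOperator (T - ContinuousLinearMap.id ℂ X)) :
    linearIndex T.toLinearMap = 0 := by
  obtain ⟨e, he⟩ := exists_continuousLinearEquiv_equiv hT
  have hF : T.IsFredholm :=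
    IsParametrix.isFredholm (B := ContinuousLinearMap.id ℂ X) ⟨hT, hT⟩
  rw [linearIndex_congr (finiteKerCoker_of_isFredholm hF)
    (FiniteKerCoker.of_bijective e.bijective) he]
  exact linearIndex_of_bijective e.bijective

theorem IsParametrix.linearIndex_add {B : Y →L[ℂ] X} {A : X →L[ℂ] Y} (h : IsParametrix B A) :
    linearIndex B.toLinearMap + linearIndex A.toLinearMap = 0 := by
  have h1 := linearIndex_comp (finiteKerCoker_of_isFredholm h.symm.isFredholm)
    (finiteKerCoker_of_isFredholm h.isFredholm)
  have h2 := linearIndex_eq_zero_of_sub_id h.left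
  rw [ContinuousLinearMap.toLinearMap_comp] at h2
  rw [← h1, h2]

theorem IsParametrix.congr {B : Y →L[ℂ] X} {A A' : X →L[ℂ] Y} (h : IsParametrix B A)
    (hA : IsCompactOperator (A' - A)) : IsParametrix B A' := by
  refine ⟨?_, ?_⟩
  · have h1 : B ∘L A' - ContinuousLinearMap.id ℂ X
        = (B ∘L A - ContinuousLinearMap.id ℂ X) + B ∘L (A' - A) := by
      ext x
      simp
    rw [h1]
    exact h.left.add (hA.clm_comp B)
  · have h1 : A' ∘L B - ContinuousLinearMap.id ℂ Y
        = (A ∘L B - ContinuousLinearMap.id ℂ Y) + (A' - A) ∘L B := by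
      ext x
      simp
    rw [h1]
    exact h.right.add (hA.comp_clm B)

/-- The index is invariant under compact perturbations. -/
theorem IsParametrix.linearIndex_eq {B : Y →L[ℂ] X} {A A' : X →L[ℂ] Y} (h : IsParametrix B A)
    (hA : IsCompactOperator (A' - A)) :
    linearIndex A'.toLinearMap = linearIndex A.toLinearMap := by
  have h1 := h.linearIndex_add
  have h2 := (h.congr hA).linearIndex_add
  omega

/-- The range is closed, so the cokernel is isomorphic to the orthogonal complement of the range,
which is Ker T*. -/
theorem fredholmIndex_eq_linearIndex {T : X →L[ℂ] X} (hT : T.IsFredholm) :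
    fredholmIndex T = linearIndex T.toLinearMap := by
  have := hT.isClosed_range.completeSpace_coe
  have h := (Submodule.quotientEquivOfIsCompl T.range T.rangeᗮ
    (Submodule.isCompl_orthogonal _)).finrank_eq
  rw [fredholmIndex, linearIndex, h, ContinuousLinearMap.orthogonal_range]

end Parametrix

/-! ### The relative index of a pair of projections -/

section RelativeIndex

variable {H : Type*} [NormedAddCommGroup H] [InnerProductSpace ℂ H]

/-- The operator `R` from the range of `Q` to the range of `R`. -/
def cut (Q R : H →L[ℂ] H) : Q.range →L[ℂ] R.range :=
  (R ∘L Q.range.subtypeL).codRestrict R.range (fun x => ⟨x, rfl⟩)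

@[simp]
theorem coe_cut_apply (Q R : H →L[ℂ] H) (x : Q.range) : (cut Q R x : H) = R x := rfl

/-- The relative index `"dim Q - dim R"` of two projections. -/
def relativeIndex (Q R : H →L[ℂ] H) : ℤ := linearIndex (cut Q R).toLinearMap

variable [CompleteSpace H] {Q R S : H →L[ℂ] H}

theorem apply_of_mem_range (hQ : IsStarProjection Q) (x : Q.range) : Q x = x := by
  obtain ⟨_, y, rfl⟩ := x
  exact DFunLike.congr_fun hQ.isIdempotentElem.eq y

theorem cut_self (hQ : IsStarProjection Q) : cut Q Q = ContinuousLinearMap.id ℂ Q.range := by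
  ext x
  exact apply_of_mem_range hQ x

theorem relativeIndex_self (hQ : IsStarProjection Q) : relativeIndex Q Q = 0 := by
  rw [relativeIndex, cut_self hQ]
  exact linearIndex_of_bijective Function.bijective_id

omit [CompleteSpace H] in
theorem isCompactOperator_sub_comm {A B : H →L[ℂ] H} (h : IsCompactOperator (A - B)) :
    IsCompactOperator (B - A) := by
  rw [← neg_sub]
  exact h.neg

/-- On Ran Q the difference is S(R - Q), and compactness survives restricting the codomain because
Ran S is closed. -/
theorem isCompactOperator_cut_comp_cut_sub (hQ : IsStarProjection Q) (hS : IsStarProjection S)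
    (h : IsCompactOperator (R - Q)) :
    IsCompactOperator (cut R S ∘L cut Q R - cut Q S) := by
  have h1 : IsCompactOperator ((S ∘L (R - Q)) ∘L Q.range.subtypeL) :=
    (h.clm_comp S).comp_clm Q.range.subtypeL
  have h2 : IsCompactOperator (((S ∘L (R - Q)) ∘L Q.range.subtypeL).codRestrict S.range
      (fun x => ⟨_, rfl⟩)) :=
    h1.codRestrict (V := S.range) (fun x => ⟨_, rfl⟩)
      (ContinuousLinearMap.IsIdempotentElem.isClosed_range hS.isIdempotentElem)
  have h3 : cut R S ∘L cut Q R - cut Q S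
      = ((S ∘L (R - Q)) ∘L Q.range.subtypeL).codRestrict S.range (fun x => ⟨_, rfl⟩) := by
    ext x
    simp [apply_of_mem_range hQ]
  rwa [h3]

theorem isParametrix_cut (hQ : IsStarProjection Q) (hR : IsStarProjection R)
    (h : IsCompactOperator (Q - R)) : IsParametrix (cut R Q) (cut Q R) := by
  refine ⟨?_, ?_⟩
  · rw [← cut_self hQ]
    exact isCompactOperator_cut_comp_cut_sub hQ hQ (isCompactOperator_sub_comm h)
  · rw [← cut_self hR]
    exact isCompactOperator_cut_comp_cut_sub hR hR h

theorem relativeIndex_trans (hQ : IsStarProjection Q) (hR : IsStarProjection R)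
    (hS : IsStarProjection S) (hQR : IsCompactOperator (Q - R)) (hRS : IsCompactOperator (R - S)) :
    relativeIndex Q S = relativeIndex Q R + relativeIndex R S := by
  have := completeSpace_range hQ
  have := completeSpace_range hR
  have := completeSpace_range hS
  have hQS : IsCompactOperator (Q - S) := by
    rw [← sub_add_sub_cancel Q R S]
    exact hQR.add hRS
  have h1 := (isParametrix_cut hQ hS hQS).linearIndex_eq
    (isCompactOperator_cut_comp_cut_sub hQ hS (isCompactOperator_sub_comm hQR))
  have h2 := linearIndex_comp
    (finiteKerCoker_of_isFredholm (isParametrix_cut hR hS hRS).isFredholm)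
    (finiteKerCoker_of_isFredholm (isParametrix_cut hQ hR hQR).isFredholm)
  rw [ContinuousLinearMap.toLinearMap_comp] at h1
  simp only [relativeIndex]
  omega

theorem relativeIndex_symm (hQ : IsStarProjection Q) (hR : IsStarProjection R)
    (hQR : IsCompactOperator (Q - R)) : relativeIndex R Q = -relativeIndex Q R := by
  have h := relativeIndex_trans hQ hR hQ hQR (isCompactOperator_sub_comm hQR)
  rw [relativeIndex_self hQ] at h
  omega

/-- On Ran Q the composition differs from the identity by Q(Q - R), of norm less than one, so a
Neumann series inverts it. -/
theorem bijective_cut_comp_cut (hQ : IsStarProjection Q) (h : ‖Q - R‖ < 1) :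
    Function.Bijective (cut R Q ∘L cut Q R) := by
  have := completeSpace_range hQ
  have hlt : ‖ContinuousLinearMap.id ℂ Q.range - cut R Q ∘L cut Q R‖ < 1 := by
    refine lt_of_le_of_lt (ContinuousLinearMap.opNorm_le_bound _ (norm_nonneg (Q - R)) ?_) h
    intro x
    have h1 : ((ContinuousLinearMap.id ℂ Q.range - cut R Q ∘L cut Q R) x : H)
        = Q ((Q - R) (x : H)) := by
      simp [apply_of_mem_range hQ]
    change ‖((ContinuousLinearMap.id ℂ Q.range - cut R Q ∘L cut Q R) x : H)‖ ≤ _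
    rw [h1]
    calc ‖Q ((Q - R) (x : H))‖ ≤ ‖Q‖ * ‖(Q - R) (x : H)‖ := Q.le_opNorm _
      _ ≤ 1 * (‖Q - R‖ * ‖(x : H)‖) := by
          gcongr
          · exact hQ.norm_le
          · exact (Q - R).le_opNorm _
      _ = _ := by rw [one_mul]; rfl
  have hu := isUnit_one_sub_of_norm_lt_one
    (x := (ContinuousLinearMap.id ℂ Q.range - cut R Q ∘L cut Q R : Q.range →L[ℂ] Q.range)) hlt
  rw [ContinuousLinearMap.one_def, sub_sub_cancel] at hu
  exact ContinuousLinearMap.isUnit_iff_bijective.mp hu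

theorem relativeIndex_of_norm_sub_lt_one (hQ : IsStarProjection Q) (hR : IsStarProjection R)
    (h : ‖Q - R‖ < 1) : relativeIndex Q R = 0 := by
  have h1 := bijective_cut_comp_cut hQ h
  have h2 := bijective_cut_comp_cut hR (by rwa [norm_sub_rev])
  rw [ContinuousLinearMap.coe_comp] at h1 h2
  exact linearIndex_of_bijective ⟨h1.1.of_comp, h2.2.of_comp⟩

/-- For a projection `R` below `Q` the relative index is the rank of the difference. -/
theorem relativeIndex_of_mul_eq (hQ : IsStarProjection Q) (hR : IsStarProjection R)
    (h : R * Q = R) (h' : Q * R = R) :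
    relativeIndex Q R = rk (Q - R) := by
  have happ : ∀ x, R (Q x) = R x := fun x => DFunLike.congr_fun h x
  have happ' : ∀ x, Q (R x) = R x := fun x => DFunLike.congr_fun h' x
  have hRR : ∀ x, R (R x) = R x := fun x => DFunLike.congr_fun hR.isIdempotentElem.eq x
  have hsurj : Function.Surjective (cut Q R) := by
    rintro ⟨_, x, rfl⟩
    exact ⟨⟨R x, R x, happ' x⟩, Subtype.ext (hRR x)⟩
  have e : (cut Q R).ker ≃ₗ[ℂ] (Q - R).range :=
    { toFun := fun x => ⟨x.1.1, x.1.1, by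
        have h1 : R x.1.1 = 0 := congrArg Subtype.val x.2
        have h2 : Q x.1.1 = x.1.1 := apply_of_mem_range hQ x.1
        simp [h1, h2]⟩
      invFun := fun x => ⟨⟨x.1, by
        obtain ⟨_, y, rfl⟩ := x
        exact ⟨y - R y, by simp [happ']⟩⟩, by
        obtain ⟨_, y, rfl⟩ := x
        refine Subtype.ext ?_
        simp [happ, hRR]⟩
      left_inv := fun _ => rfl
      right_inv := fun _ => rfl
      map_add' := fun _ _ => rfl
      map_smul' := fun _ _ => rfl }
  rw [relativeIndex, linearIndex, LinearMap.range_eq_top.mpr hsurj,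
    Module.finrank_zero_of_subsingleton (M := R.range ⧸ (⊤ : Submodule ℂ R.range)), rk,
    ← e.finrank_eq, Nat.cast_zero, sub_zero]

/-- The relative index of two projections on a norm continuous path vanishes. -/
theorem relativeIndex_eq_zero_of_continuousOn {E : ℝ → (H →L[ℂ] H)} {s : Set ℝ}
    (hs : IsPreconnected s) (hE : ContinuousOn E s) (hP : ∀ t ∈ s, IsStarProjection (E t))
    (hK : ∀ t ∈ s, ∀ t' ∈ s, IsCompactOperator (E t - E t')) {t t' : ℝ} (ht : t ∈ s)
    (ht' : t' ∈ s) : relativeIndex (E t) (E t') = 0 := by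
  -- An integer-valued function is constant on a preconnected set once it is locally constant;
  -- additivity and vanishing at distance less than one give the latter.
  have hcont : ContinuousOn (fun r => relativeIndex (E t) (E r)) s := by
    intro r hr
    refine continuousWithinAt_const (b := relativeIndex (E t) (E r)) |>.congr_of_eventuallyEq ?_ rfl
    have h1 : ∀ᶠ x in nhdsWithin r s, ‖E r - E x‖ < 1 := by
      have h2 := (hE r hr).eventually (Metric.ball_mem_nhds (E r) one_pos)
      filter_upwards [h2] with x hx
      rwa [← dist_eq_norm, dist_comm]
    filter_upwards [h1, self_mem_nhdsWithin] with x hx hxs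
    rw [relativeIndex_trans (hP t ht) (hP r hr) (hP x hxs) (hK _ ht _ hr) (hK _ hr _ hxs),
      relativeIndex_of_norm_sub_lt_one (hP r hr) (hP x hxs) hx, add_zero]
  have h := hs.constant hcont ht ht'
  rw [← h, relativeIndex_self (hP t ht)]

end RelativeIndex

/-! ### Spectral projections at isolated points -/

section Isolated

/-- The point `c` is not an accumulation point of `S`. -/
def IsolatedIn (S : Set ℝ) (c : ℝ) : Prop := ∃ δ > 0, ∀ x ∈ S, x ≠ c → δ ≤ |x - c|

theorem IsolatedIn.mono {S S' : Set ℝ} {c : ℝ} (h : IsolatedIn S c) (hS : S' ⊆ S) :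
    IsolatedIn S' c := by
  obtain ⟨δ, hδ, h⟩ := h
  exact ⟨δ, hδ, fun x hx => h x (hS hx)⟩

theorem IsolatedIn.union {S S' : Set ℝ} {c : ℝ} (h : IsolatedIn S c) (h' : IsolatedIn S' c) :
    IsolatedIn (S ∪ S') c := by
  obtain ⟨δ, hδ, h⟩ := h
  obtain ⟨δ', hδ', h'⟩ := h'
  refine ⟨min δ δ', lt_min hδ hδ', ?_⟩
  rintro x (hx | hx) hxc
  · exact (min_le_left _ _).trans (h x hx hxc)
  · exact (min_le_right _ _).trans (h' x hx hxc)

theorem isolatedIn_of_notMem {S : Set ℝ} {c : ℝ} (hS : IsClosed S) (hc : c ∉ S) :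
    IsolatedIn S c := by
  obtain ⟨δ, hδ, h⟩ := Metric.isOpen_iff.mp hS.isOpen_compl c hc
  refine ⟨δ, hδ, fun x hx _ => ?_⟩
  by_contra hlt
  exact h (by rwa [Metric.mem_ball, Real.dist_eq, ← not_le]) hx

/-- The indicator function of `(c, ∞)`. -/
def upperIndicator (c x : ℝ) : ℝ := if c < x then 1 else 0

theorem upperIndicator_mul {a b : ℝ} (h : a ≤ b) (x : ℝ) :
    upperIndicator a x * upperIndicator b x = upperIndicator b x := by
  unfold upperIndicator
  split_ifs <;> grind

/-- On `S` the jump agrees with a linear ramp rising from 0 at `c` to 1 at `c + δ`. The point `c`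
may itself belong to `S`. -/
theorem IsolatedIn.continuousOn {S : Set ℝ} {c : ℝ} (h : IsolatedIn S c) :
    ContinuousOn (upperIndicator c) S := by
  obtain ⟨δ, hδ, h⟩ := h
  have heq : Set.EqOn (upperIndicator c) (fun x => max 0 (min 1 ((x - c) / δ))) S := by
    intro x hx
    unfold upperIndicator
    by_cases hxc : x = c
    · simp [hxc]
    · have h1 := h x hx hxc
      split_ifs with h2
      · rw [abs_of_pos (by linarith)] at h1
        have : 1 ≤ (x - c) / δ := by rwa [one_le_div hδ]
        change 1 = max 0 (min 1 ((x - c) / δ))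
        rw [min_eq_left this, max_eq_right zero_le_one]
      · have : (x - c) / δ ≤ 0 := div_nonpos_of_nonpos_of_nonneg (by linarith) hδ.le
        change 0 = max 0 (min 1 ((x - c) / δ))
        rw [max_eq_left ((min_le_right _ _).trans this)]
  exact ContinuousOn.congr (by fun_prop) heq

end Isolated

/-! ### Spectral projections as functional calculus of an indicator, and their continuity. -/

section SpectralProjection

open Filter Topology

variable {H : Type*} [NormedAddCommGroup H] [InnerProductSpace ℂ H] [CompleteSpace H]

/-- The spectral projection `χ_{(c, ∞)}(T)`. -/
def spectralProjIoi (T : H →L[ℂ] H) (c : ℝ) : H →L[ℂ] H := 1 - spectralProjIic T c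

theorem isStarProjection_spectralProjIoi (T : H →L[ℂ] H) (c : ℝ) :
    IsStarProjection (spectralProjIoi T c) :=
  IsStarProjection.one_sub isStarProjection_starProjection

theorem spectralProjIoc_eq_sub (T : H →L[ℂ] H) (a b : ℝ) :
    spectralProjIoc T a b = spectralProjIoi T a - spectralProjIoi T b := by
  simp only [spectralProjIoc, spectralProjIoi]
  abel

theorem isStarProjection_cfc_upperIndicator {T : H →L[ℂ] H} {c : ℝ}
    (hc : IsolatedIn (spectrum ℝ T) c) : IsStarProjection (cfc (upperIndicator c) T) := by
  have := hc.continuousOn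
  refine ⟨?_, cfc_predicate _ _⟩
  rw [IsIdempotentElem, ← cfc_mul _ _ T]
  exact cfc_congr fun x _ => upperIndicator_mul le_rfl x

/-- On the spectrum the indicator and (x - c)₊ are continuous multiples of each other, with factor 1
/ max(x - c, δ) in one direction. So (T - c)₊ and the indicator of T have the same kernel, and a
projection is determined by its range. -/
theorem spectralProjIoi_eq_cfc {T : H →L[ℂ] H} {c : ℝ}
    (hc : IsolatedIn (spectrum ℝ T) c) : spectralProjIoi T c = cfc (upperIndicator c) T := by
  have hcont := hc.continuousOn
  have hE := isStarProjection_cfc_upperIndicator hc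
  obtain ⟨δ, hδ, hsep⟩ := hc
  have hk : Continuous fun x : ℝ => (max (x - c) δ)⁻¹ :=
    Continuous.inv₀ (by fun_prop) fun x => (lt_max_of_lt_right hδ).ne'
  have h1 : cfc (fun x : ℝ => max (x - c) 0) T
      = cfc (fun x : ℝ => max (x - c) 0) T * cfc (upperIndicator c) T := by
    rw [← cfc_mul _ _ T]
    refine cfc_congr fun x _ => ?_
    simp only [upperIndicator]
    split_ifs with h
    · simp
    · simp [not_lt.mp h]
  have h2 : cfc (upperIndicator c) T
      = cfc (fun x : ℝ => (max (x - c) δ)⁻¹) T * cfc (fun x : ℝ => max (x - c) 0) T := by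
    rw [← cfc_mul _ _ T hk.continuousOn]
    refine cfc_congr fun x hx => ?_
    simp only [upperIndicator]
    split_ifs with h
    · have h3 := hsep x hx h.ne'
      rw [abs_of_pos (by linarith)] at h3
      rw [max_eq_left h3, max_eq_left (by linarith), inv_mul_cancel₀ (by linarith)]
    · simp [not_lt.mp h]
  have hker : (cfc (fun x : ℝ => max (x - c) 0) T).ker = (1 - cfc (upperIndicator c) T).range := by
    ext x
    constructor
    · intro hx
      refine ⟨x, ?_⟩
      have h3 : cfc (upperIndicator c) T x = 0 := by
        rw [h2]
        change cfc (fun x : ℝ => (max (x - c) δ)⁻¹) T (cfc (fun x : ℝ => max (x - c) 0) T x) = 0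
        rw [show cfc (fun x : ℝ => max (x - c) 0) T x = 0 from hx, map_zero]
      simp [h3]
    · rintro ⟨y, rfl⟩
      change (cfc (fun x : ℝ => max (x - c) 0) T * (1 - cfc (upperIndicator c) T)) y = 0
      rw [mul_sub, mul_one, ← h1, sub_self]
      rfl
  have h3 : spectralProjIic T c = 1 - cfc (upperIndicator c) T := by
    refine (ContinuousLinearMap.IsStarProjection.ext_iff isStarProjection_starProjection
      hE.one_sub).mpr ?_
    rw [Submodule.range_starProjection, hker]
  rw [spectralProjIoi, h3, sub_sub_cancel]

theorem spectralProjIoi_mul {T : H →L[ℂ] H} {a b : ℝ}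
    (ha : IsolatedIn (spectrum ℝ T) a) (hb : IsolatedIn (spectrum ℝ T) b) (hab : a ≤ b) :
    spectralProjIoi T a * spectralProjIoi T b = spectralProjIoi T b := by
  have := ha.continuousOn
  have := hb.continuousOn
  rw [spectralProjIoi_eq_cfc ha, spectralProjIoi_eq_cfc hb, ← cfc_mul _ _ T]
  exact cfc_congr fun x _ => upperIndicator_mul hab x

theorem spectralProjIoi_mul' {T : H →L[ℂ] H} {a b : ℝ}
    (ha : IsolatedIn (spectrum ℝ T) a) (hb : IsolatedIn (spectrum ℝ T) b) (hab : a ≤ b) :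
    spectralProjIoi T b * spectralProjIoi T a = spectralProjIoi T b := by
  have h := congrArg star (spectralProjIoi_mul ha hb hab)
  rwa [star_mul, (isStarProjection_spectralProjIoi T a).isSelfAdjoint.star_eq,
    (isStarProjection_spectralProjIoi T b).isSelfAdjoint.star_eq] at h

/-- Spectral projections do not change if the threshold moves through a gap. -/
theorem spectralProjIoi_congr {T : H →L[ℂ] H} {a b : ℝ}
    (ha : IsolatedIn (spectrum ℝ T) a) (hb : IsolatedIn (spectrum ℝ T) b)
    (h : ∀ x ∈ spectrum ℝ T, a < x ↔ b < x) : spectralProjIoi T a = spectralProjIoi T b := by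
  rw [spectralProjIoi_eq_cfc ha, spectralProjIoi_eq_cfc hb]
  refine cfc_congr fun x hx => ?_
  simp only [upperIndicator, h x hx]

theorem eventually_spectrum_subset {s : Set ℝ} {γ : ℝ → (H →L[ℂ] H)} {t : ℝ}
    (hγ : ContinuousWithinAt γ s t) {k : Set ℝ} (hk : k ∈ 𝓝ˢ (spectrum ℝ (γ t))) :
    ∀ᶠ r in 𝓝[s] t, spectrum ℝ (γ r) ⊆ k := by
  have h := (upperHemicontinuous_spectrum ℝ (H →L[ℂ] H)).isOpen k
  filter_upwards [hγ.eventually (h.mem_nhds hk)] with r hr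
  exact subset_of_mem_nhdsSet hr

/-- Spectral projections are norm continuous away from the spectrum. -/
theorem continuousWithinAt_spectralProjIoi {s : Set ℝ} {γ : ℝ → (H →L[ℂ] H)} {t c : ℝ}
    (ht : t ∈ s) (hγ : ContinuousWithinAt γ s t) (hsa : ∀ r ∈ s, IsSelfAdjoint (γ r))
    (hc : c ∉ spectrum ℝ (γ t)) :
    ContinuousWithinAt (fun r => spectralProjIoi (γ r) c) s t := by
  have hs := ContinuousFunctionalCalculus.isCompact_spectrum (R := ℝ) (γ t)
  have hmem : {c}ᶜ ∈ 𝓝ˢ (spectrum ℝ (γ t)) :=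
    isOpen_compl_singleton.mem_nhdsSet.mpr fun x hx hxc => hc (hxc ▸ hx)
  -- A compact neighbourhood of the spectrum avoiding `c` contains all nearby spectra, so one
  -- function, continuous on `k`, computes all nearby projections.
  obtain ⟨k, ⟨hk, hkc⟩, hkc'⟩ := hs.nhdsSet_basis_isCompact.mem_iff.mp hmem
  have hiso : IsolatedIn k c := isolatedIn_of_notMem hkc.isClosed fun h => hkc' h rfl
  have hev := eventually_spectrum_subset hγ hk
  have h1 : ContinuousWithinAt (fun r => cfc (upperIndicator c) (γ r)) s t := by
    refine ContinuousWithinAt.cfc hkc _ ht hγ hev ?_ hiso.continuousOn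
    filter_upwards [self_mem_nhdsWithin] with r hr using hsa r hr
  refine h1.congr_of_eventuallyEq ?_ ?_
  · filter_upwards [hev, self_mem_nhdsWithin] with r hr hrs
    exact spectralProjIoi_eq_cfc (hiso.mono hr)
  · exact spectralProjIoi_eq_cfc (hiso.mono (subset_of_mem_nhdsSet hk))

end SpectralProjection

/-! ### Compact perturbations of symmetries -/

section CompactPerturbation

open Filter Topology

variable {H : Type*} [NormedAddCommGroup H] [InnerProductSpace ℂ H] [CompleteSpace H]

/-- The functional calculus preserves congruence modulo compact operators. -/
theorem isCompactOperator_cfc_sub_cfc {T S : H →L[ℂ] H} (hT : IsSelfAdjoint T)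
    (hS : IsSelfAdjoint S) (h : IsCompactOperator (T - S)) {f : ℝ → ℝ}
    (hf : ContinuousOn f (spectrum ℝ T ∪ spectrum ℝ S)) :
    IsCompactOperator (cfc f T - cfc f S) := by
  set s := spectrum ℝ T ∪ spectrum ℝ S with hs
  have hTs : spectrum ℝ T ⊆ s := Set.subset_union_left
  have hSs : spectrum ℝ S ⊆ s := Set.subset_union_right
  have hcs : IsCompact s :=
    (ContinuousFunctionalCalculus.isCompact_spectrum (R := ℝ) T).union
      (ContinuousFunctionalCalculus.isCompact_spectrum (R := ℝ) S)
  have : CompactSpace s := isCompact_iff_compactSpace.mp hcs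
  -- Stone–Weierstrass induction on the union of the spectra: the claim holds for constants and the
  -- identity, and passes to sums, products and uniform limits, the compact operators being a closed
  -- ideal.
  have key : ∀ g : C(s, ℝ),
      IsCompactOperator (cfcHomSuperset hT hTs g - cfcHomSuperset hS hSs g) := by
    intro g
    induction g using ContinuousMap.induction_on_of_compact with
    | const r =>
      have h1 : ContinuousMap.const s r = algebraMap ℝ C(s, ℝ) r := rfl
      rw [h1, AlgHomClass.commutes, AlgHomClass.commutes, sub_self]
      exact isCompactOperator_zero
    | id =>
      rw [cfcHomSuperset_id, cfcHomSuperset_id]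
      exact h
    | star_id =>
      rw [map_star, map_star, cfcHomSuperset_id, cfcHomSuperset_id, hT.star_eq, hS.star_eq]
      exact h
    | add f g hf hg =>
      rw [map_add, map_add, add_sub_add_comm]
      exact hf.add hg
    | mul f g hf hg =>
      rw [map_mul, map_mul]
      have h1 : ∀ a b c d : H →L[ℂ] H, a * b - c * d = (a - c) ∘L b + c ∘L (b - d) := by
        intro a b c d
        simp only [← ContinuousLinearMap.mul_def]
        noncomm_ring
      rw [h1]
      exact (hf.comp_clm _).add (hg.clm_comp _)
    | frequently g hg =>
      have hcl : IsClosed {g : C(s, ℝ) |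
          IsCompactOperator (cfcHomSuperset hT hTs g - cfcHomSuperset hS hSs g)} :=
        isClosed_setOfPred_isCompactOperator.preimage
          ((cfcHomSuperset_continuous hT hTs).sub (cfcHomSuperset_continuous hS hSs))
      exact hcl.mem_of_frequently_of_tendsto hg tendsto_id
  have hT' : cfc f T = cfcHomSuperset hT hTs ⟨s.domRestrict f, hf.domRestrict⟩ := by
    rw [cfcHomSuperset_apply, cfc_apply f T hT (hf.mono hTs)]
    rfl
  have hS' : cfc f S = cfcHomSuperset hS hSs ⟨s.domRestrict f, hf.domRestrict⟩ := by
    rw [cfcHomSuperset_apply, cfc_apply f S hS (hf.mono hSs)]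
    rfl
  rw [hT', hS']
  exact key _

theorem isSelfAdjoint_two_mul_sub_one {P : H →L[ℂ] H} (hP : IsStarProjection P) :
    IsSelfAdjoint (2 * P - 1) := by
  have := hP.isSelfAdjoint.star_eq
  simp [IsSelfAdjoint, this, two_mul]

/-- The symmetry 2P - 1 squares to the identity. The resulting difference of squares supplies an
explicit inverse of 2P - 1 - c whenever c² ≠ 1. -/
theorem sub_mul_add_of_isStarProjection {P : H →L[ℂ] H} (hP : IsStarProjection P) (c : ℝ) :
    (2 * P - 1 - c • 1) * (2 * P - 1 + c • 1) = (1 - c ^ 2) • (1 : H →L[ℂ] H) := by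
  have h := hP.isIdempotentElem.eq
  have h2 : (2 * P - 1) * (2 * P - 1) = 1 := by
    have : (2 * P - 1) * (2 * P - 1) = 4 * (P * P) - 4 * P + 1 := by noncomm_ring
    rw [this, h, sub_self, zero_add]
  rw [sub_mul, smul_mul_assoc, one_mul, mul_add, h2, mul_smul_comm, mul_one, smul_add, smul_smul,
    ← sq, sub_smul, one_smul]
  abel

theorem exists_unit_eq_two_mul_sub_one_sub {P : H →L[ℂ] H} (hP : IsStarProjection P) {c : ℝ}
    (hc' : 1 - c ^ 2 ≠ 0) : ∃ u : (H →L[ℂ] H)ˣ, (u : H →L[ℂ] H) = 2 * P - 1 - c • 1 := by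
  have h1 := sub_mul_add_of_isStarProjection hP c
  have h2 : (2 * P - 1 + c • 1) * (2 * P - 1 - c • 1) = (1 - c ^ 2) • (1 : H →L[ℂ] H) := by
    have := sub_mul_add_of_isStarProjection hP (-c)
    rwa [neg_smul, sub_neg_eq_add, ← sub_eq_add_neg, neg_sq] at this
  refine ⟨⟨2 * P - 1 - c • 1, (1 - c ^ 2)⁻¹ • (2 * P - 1 + c • 1), ?_, ?_⟩, rfl⟩
  · rw [mul_smul_comm, h1, smul_smul, inv_mul_cancel₀ hc', one_smul]
  · rw [smul_mul_assoc, h2, smul_smul, inv_mul_cancel₀ hc', one_smul]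

/-- Spectral values of a compact perturbation of `2 P - 1` are isolated in `(-1, 1)`. -/
theorem isolatedIn_spectrum {T P : H →L[ℂ] H} (hT : IsSelfAdjoint T) (hP : IsStarProjection P)
    (h : IsCompactOperator (T - (2 * P - 1) : H →L[ℂ] H)) {c : ℝ} (hc : c ∈ Set.Ioo (-1 : ℝ) 1) :
    IsolatedIn (spectrum ℝ T) c := by
  obtain ⟨u, hu⟩ := exists_unit_eq_two_mul_sub_one_sub hP
    (c := c) (by nlinarith [hc.1, hc.2])
  have hpar : IsParametrix (↑u⁻¹ : H →L[ℂ] H) (u : H →L[ℂ] H) := by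
    refine ⟨?_, ?_⟩
    · rw [← ContinuousLinearMap.mul_def, u.inv_mul, ContinuousLinearMap.one_def, sub_self]
      exact isCompactOperator_zero
    · rw [← ContinuousLinearMap.mul_def, u.mul_inv, ContinuousLinearMap.one_def, sub_self]
      exact isCompactOperator_zero
  set D : H →L[ℂ] H := T - c • 1 with hD
  have hDu : IsCompactOperator (D - (u : H →L[ℂ] H)) := by
    rw [hu, hD, sub_sub_sub_cancel_right]
    exact h
  have hDsa : star D = D := by simp [hD, hT.star_eq]
  have hfin : FiniteDimensional ℂ D.ker := (hpar.congr hDu).isFredholm.finite_ker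
  -- Adding the finite rank projection onto Ker D makes `D` injective; `D + Q` is a compact
  -- perturbation of the invertible `u`, hence of index zero, hence also surjective.
  set Q : H →L[ℂ] H := D.ker.starProjection with hQ
  have hQsp : IsStarProjection Q := isStarProjection_starProjection
  have hDQ : D * Q = 0 := by
    ext x
    exact Submodule.starProjection_apply_mem D.ker x
  have hQD : Q * D = 0 := by
    have := congrArg star hDQ
    rwa [star_mul, hDsa, hQsp.isSelfAdjoint.star_eq, star_zero] at this
  have hQc : IsCompactOperator Q := by
    have h1 : Q = D.ker.subtypeL ∘L D.ker.orthogonalProjectionOnto := rfl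
    rw [h1]
    have : ProperSpace D.ker := FiniteDimensional.proper ℂ _
    have h2 := isCompactOperator_of_locallyCompactSpace_rng D.ker.subtypeL
    exact h2.comp_clm D.ker.orthogonalProjectionOnto
  have hDQu : IsCompactOperator (D + Q - (u : H →L[ℂ] H)) := by
    rw [add_sub_right_comm]
    exact hDu.add hQc
  have hinj : Function.Injective (D + Q) := by
    rw [injective_iff_map_eq_zero]
    intro x hx
    have h1 : Q x = 0 := by
      have : (Q * (D + Q)) x = 0 := by
        change Q ((D + Q) x) = 0
        rw [hx, map_zero]
      rwa [mul_add, hQD, zero_add, hQsp.isIdempotentElem.eq] at this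
    have h2 : D x = 0 := by simpa [h1] using hx
    have h3 : Q x = x := Submodule.starProjection_eq_self_iff.mpr h2
    rw [← h3, h1]
  have hsurj : Function.Surjective (D + Q) := by
    have h1 := hpar.linearIndex_eq hDQu
    have hub : Function.Bijective (u : H →L[ℂ] H) :=
      ContinuousLinearMap.isUnit_iff_bijective.mp u.isUnit
    have h2 : linearIndex (u : H →L[ℂ] H).toLinearMap = 0 := linearIndex_of_bijective hub
    have h3 := (hpar.congr hDQu).isFredholm.finite_coker
    rw [h2, linearIndex, LinearMap.ker_eq_bot.mpr hinj, finrank_bot, Nat.cast_zero, zero_sub,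
      neg_eq_zero, Nat.cast_eq_zero, Module.finrank_zero_iff,
      Submodule.Quotient.subsingleton_iff] at h1
    exact LinearMap.range_eq_top.mp h1
  have hunit : IsUnit (D + Q) := ContinuousLinearMap.isUnit_iff_bijective.mpr ⟨hinj, hsurj⟩
  have hopen : IsOpen {e : ℝ | IsUnit (D + Q - e • (1 : H →L[ℂ] H))} :=
    Units.isOpen.preimage (by fun_prop)
  obtain ⟨δ, hδ, hball⟩ := Metric.isOpen_iff.mp hopen 0 (by simpa using hunit)
  refine ⟨δ, hδ, fun x hx hxc => ?_⟩
  by_contra hlt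
  have h1 : IsUnit (D + Q - (x - c) • (1 : H →L[ℂ] H)) :=
    hball (by simpa [Real.dist_eq] using hlt)
  have hxc' : x - c ≠ 0 := sub_ne_zero.mpr hxc
  -- With e = x - c nonzero, D + Q - e factors as (D - e)(1 - e⁻¹Q) with commuting factors. Its
  -- invertibility for |e| < δ forces that of D - e = T - x, contradicting that x is spectral.
  set A : H →L[ℂ] H := D - (x - c) • 1 with hA
  set B : H →L[ℂ] H := 1 - (x - c)⁻¹ • Q with hB
  have hAB : A * B = D + Q - (x - c) • (1 : H →L[ℂ] H) := by
    rw [hA, hB, mul_sub, mul_one, mul_smul_comm, sub_mul, hDQ, smul_mul_assoc, one_mul, zero_sub,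
      smul_neg, smul_smul, inv_mul_cancel₀ hxc', one_smul]
    abel
  have hBA : B * A = D + Q - (x - c) • (1 : H →L[ℂ] H) := by
    rw [hA, hB, sub_mul, one_mul, smul_mul_assoc, mul_sub, hQD, mul_smul_comm, mul_one, zero_sub,
      smul_neg, smul_smul, inv_mul_cancel₀ hxc', one_smul]
    abel
  have hAu : IsUnit A := by
    have hcomm : Commute A B := hAB.trans hBA.symm
    exact (hcomm.isUnit_mul_iff.mp (hAB ▸ h1)).1
  refine spectrum.mem_iff.mp hx ?_
  have : algebraMap ℝ (H →L[ℂ] H) x - T = -A := by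
    rw [Algebra.algebraMap_eq_smul_one, hA, hD, sub_smul]
    abel
  rw [this]
  exact hAu.neg

/-- The spectrum lies in {-1, 1}, where the indicator coincides with (x + 1)/2. -/
theorem spectralProjIoi_two_mul_sub_one {P : H →L[ℂ] H} (hP : IsStarProjection P) {c : ℝ}
    (hc : c ∈ Set.Ioo (-1 : ℝ) 1) : spectralProjIoi (2 * P - 1) c = P := by
  have hsa := isSelfAdjoint_two_mul_sub_one hP
  have hiso : IsolatedIn (spectrum ℝ (2 * P - 1)) c :=
    isolatedIn_spectrum hsa hP (by rw [sub_self]; exact isCompactOperator_zero) hc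
  have hspec : ∀ x ∈ spectrum ℝ (2 * P - 1), x = 1 ∨ x = -1 := by
    intro x hx
    by_contra hne
    obtain ⟨u, hu⟩ := exists_unit_eq_two_mul_sub_one_sub hP (c := x) (by
      intro h
      have : (x - 1) * (x + 1) = 0 := by linarith
      rcases mul_eq_zero.mp this with h | h
      · exact hne (Or.inl (by linarith))
      · exact hne (Or.inr (by linarith)))
    refine spectrum.mem_iff.mp hx ?_
    rw [Algebra.algebraMap_eq_smul_one, ← neg_sub, ← hu]
    exact u.isUnit.neg
  have h1 : cfc (fun x : ℝ => (1 / 2 : ℝ) * (x + 1)) (2 * P - 1) = P := by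
    rw [cfc_const_mul (1 / 2 : ℝ) (fun x => x + 1) (2 * P - 1),
      cfc_add_const 1 (fun x => x) (2 * P - 1), cfc_id' ℝ (2 * P - 1)]
    simp only [map_one, sub_add_cancel, two_mul]
    rw [← two_smul ℝ P, smul_smul]
    norm_num
  rw [spectralProjIoi_eq_cfc hiso]
  refine Eq.trans (cfc_congr fun x hx => ?_) h1
  obtain ⟨hc1, hc2⟩ := hc
  rcases hspec x hx with rfl | rfl
  · norm_num [upperIndicator, hc2]
  · simp [upperIndicator, hc1.le]

theorem isCompactOperator_spectralProjIoi_sub {T P : H →L[ℂ] H} (hT : IsSelfAdjoint T)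
    (hP : IsStarProjection P) (h : IsCompactOperator (T - (2 * P - 1) : H →L[ℂ] H)) {c : ℝ}
    (hc : c ∈ Set.Ioo (-1 : ℝ) 1) : IsCompactOperator (spectralProjIoi T c - P) := by
  have hsa := isSelfAdjoint_two_mul_sub_one hP
  have hiso := isolatedIn_spectrum hT hP h hc
  have hiso' : IsolatedIn (spectrum ℝ (2 * P - 1)) c :=
    isolatedIn_spectrum hsa hP (by rw [sub_self]; exact isCompactOperator_zero) hc
  have h1 := isCompactOperator_cfc_sub_cfc hT hsa h (hiso.union hiso').continuousOn
  rwa [← spectralProjIoi_eq_cfc hiso, ← spectralProjIoi_eq_cfc hiso',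
    spectralProjIoi_two_mul_sub_one hP hc] at h1

/-- The identity of Ran E is then compact, so Riesz's theorem applies. -/
theorem finiteDimensional_range_of_isCompactOperator {E : H →L[ℂ] H} (hE : IsStarProjection E)
    (h : IsCompactOperator E) : FiniteDimensional ℂ E.range := by
  have h1 : IsCompactOperator (cut E E) :=
    (h.comp_clm E.range.subtypeL).codRestrict (V := E.range) (fun x => ⟨_, rfl⟩)
      (ContinuousLinearMap.IsIdempotentElem.isClosed_range hE.isIdempotentElem)
  rw [cut_self hE] at h1
  exact FiniteDimensional.of_isCompactOperator_id h1

end CompactPerturbation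

/-! ### Spectral flow as a relative index -/

section Flow

open Filter Topology

variable {H : Type*} [NormedAddCommGroup H] [InnerProductSpace ℂ H] [CompleteSpace H]

/-- A continuous family of self-adjoint compact perturbations of `2 P - 1`. -/
structure IsCompactFamily (P : H →L[ℂ] H) (γ : ℝ → (H →L[ℂ] H)) (s : Set ℝ) : Prop where
  isStarProjection : IsStarProjection P
  continuousOn : ContinuousOn γ s
  selfAdjoint : ∀ t ∈ s, IsSelfAdjoint (γ t)
  compact : ∀ t ∈ s, IsCompactOperator (γ t - (2 * P - 1) : H →L[ℂ] H)

namespace IsCompactFamily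

variable {P : H →L[ℂ] H} {γ : ℝ → (H →L[ℂ] H)} {s : Set ℝ} {a b c : ℝ}

theorem mono (h : IsCompactFamily P γ s) {s' : Set ℝ} (hs : s' ⊆ s) : IsCompactFamily P γ s' :=
  ⟨h.isStarProjection, h.continuousOn.mono hs, fun t ht => h.selfAdjoint t (hs ht),
    fun t ht => h.compact t (hs ht)⟩

theorem isolatedIn (h : IsCompactFamily P γ s) (hc : c ∈ Set.Ioo (-1 : ℝ) 1) {t : ℝ}
    (ht : t ∈ s) : IsolatedIn (spectrum ℝ (γ t)) c :=
  isolatedIn_spectrum (h.selfAdjoint t ht) h.isStarProjection (h.compact t ht) hc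

theorem isCompactOperator_sub (h : IsCompactFamily P γ s) (ha : a ∈ Set.Ioo (-1 : ℝ) 1)
    (hb : b ∈ Set.Ioo (-1 : ℝ) 1) {t t' : ℝ} (ht : t ∈ s) (ht' : t' ∈ s) :
    IsCompactOperator (spectralProjIoi (γ t) a - spectralProjIoi (γ t') b) := by
  have h1 := isCompactOperator_spectralProjIoi_sub (h.selfAdjoint t ht) h.isStarProjection
    (h.compact t ht) ha
  have h2 := isCompactOperator_spectralProjIoi_sub (h.selfAdjoint t' ht') h.isStarProjection
    (h.compact t' ht') hb
  rw [← sub_sub_sub_cancel_right _ _ P]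
  exact h1.sub h2

theorem relativeIndex_trans (h : IsCompactFamily P γ s) (ha : a ∈ Set.Ioo (-1 : ℝ) 1)
    (hb : b ∈ Set.Ioo (-1 : ℝ) 1) (hc : c ∈ Set.Ioo (-1 : ℝ) 1) {t t' t'' : ℝ} (ht : t ∈ s)
    (ht' : t' ∈ s) (ht'' : t'' ∈ s) :
    relativeIndex (spectralProjIoi (γ t) a) (spectralProjIoi (γ t'') c)
      = relativeIndex (spectralProjIoi (γ t) a) (spectralProjIoi (γ t') b)
        + relativeIndex (spectralProjIoi (γ t') b) (spectralProjIoi (γ t'') c) :=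
  SpectralFlowPairing.relativeIndex_trans (isStarProjection_spectralProjIoi _ _)
    (isStarProjection_spectralProjIoi _ _) (isStarProjection_spectralProjIoi _ _)
    (h.isCompactOperator_sub ha hb ht ht') (h.isCompactOperator_sub hb hc ht' ht'')

theorem isStarProjection_sub (h : IsCompactFamily P γ s) (ha : a ∈ Set.Ioo (-1 : ℝ) 1)
    (hb : b ∈ Set.Ioo (-1 : ℝ) 1) (hab : a ≤ b) {t : ℝ} (ht : t ∈ s) :
    IsStarProjection (spectralProjIoi (γ t) a - spectralProjIoi (γ t) b) := by
  have hA := isStarProjection_spectralProjIoi (γ t) a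
  have hB := isStarProjection_spectralProjIoi (γ t) b
  refine ⟨?_, hA.isSelfAdjoint.sub hB.isSelfAdjoint⟩
  rw [IsIdempotentElem, mul_sub, sub_mul, sub_mul, hA.isIdempotentElem.eq, hB.isIdempotentElem.eq,
    spectralProjIoi_mul (h.isolatedIn ha ht) (h.isolatedIn hb ht) hab,
    spectralProjIoi_mul' (h.isolatedIn ha ht) (h.isolatedIn hb ht) hab, sub_self, sub_zero]

theorem finiteDimensional_range (h : IsCompactFamily P γ s) (ha : a ∈ Set.Ioo (-1 : ℝ) 1)
    (hb : b ∈ Set.Ioo (-1 : ℝ) 1) (hab : a ≤ b) {t : ℝ} (ht : t ∈ s) :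
    FiniteDimensional ℂ (spectralProjIoc (γ t) a b).range := by
  rw [spectralProjIoc_eq_sub]
  exact finiteDimensional_range_of_isCompactOperator (h.isStarProjection_sub ha hb hab ht)
    (h.isCompactOperator_sub ha hb ht ht)

theorem rk_spectralProjIoc (h : IsCompactFamily P γ s) (ha : a ∈ Set.Ioo (-1 : ℝ) 1)
    (hb : b ∈ Set.Ioo (-1 : ℝ) 1) (hab : a ≤ b) {t : ℝ} (ht : t ∈ s) :
    (rk (spectralProjIoc (γ t) a b) : ℤ)
      = relativeIndex (spectralProjIoi (γ t) a) (spectralProjIoi (γ t) b) := by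
  rw [spectralProjIoc_eq_sub, relativeIndex_of_mul_eq (isStarProjection_spectralProjIoi _ _)
    (isStarProjection_spectralProjIoi _ _)
    (spectralProjIoi_mul' (h.isolatedIn ha ht) (h.isolatedIn hb ht) hab)
    (spectralProjIoi_mul (h.isolatedIn ha ht) (h.isolatedIn hb ht) hab)]

theorem relativeIndex_eq_zero (h : IsCompactFamily P γ s) (hs : IsPreconnected s)
    (ha : a ∈ Set.Ioo (-1 : ℝ) 1) (hcont : ContinuousOn (fun t => spectralProjIoi (γ t) a) s)
    {t t' : ℝ} (ht : t ∈ s) (ht' : t' ∈ s) :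
    relativeIndex (spectralProjIoi (γ t) a) (spectralProjIoi (γ t') a) = 0 :=
  relativeIndex_eq_zero_of_continuousOn hs hcont
    (fun _ _ => isStarProjection_spectralProjIoi _ _)
    (fun _ hr _ hr' => h.isCompactOperator_sub ha ha hr hr') ht ht'

end IsCompactFamily

/-- The threshold of a spectral projection at an isolated point can be moved into the gap above
it. -/
theorem IsolatedIn.exists_gap {S : Set ℝ} {c : ℝ} (h : IsolatedIn S c) :
    ∃ ε₀ > 0, ∀ ε ∈ Set.Ioo 0 ε₀, c + ε ∉ S ∧ ∀ x ∈ S, c < x ↔ c + ε < x := by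
  obtain ⟨δ, hδ, h⟩ := h
  refine ⟨δ, hδ, fun ε hε => ⟨fun hmem => ?_, fun x hx => ⟨fun hcx => ?_, fun hcx => ?_⟩⟩⟩
  · have h1 := h _ hmem (by linarith [hε.1])
    rw [add_sub_cancel_left, abs_of_pos hε.1] at h1
    linarith [hε.2]
  · have h1 := h x hx hcx.ne'
    rw [abs_of_pos (by linarith)] at h1
    linarith [hε.2]
  · linarith [hε.1]

/-- For nested projections `A ≥ A' ≥ B ≥ B'` the difference `A - A'` is controlled by
`(A - A') - (B - B')`. -/
theorem norm_sub_le_norm_sub_sub_sub {A A' B B' : H →L[ℂ] H} (hX : IsStarProjection (A - A'))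
    (hAB : A * B = B) (hAB' : A * B' = B') (hA'B : A' * B = B) (hA'B' : A' * B' = B') :
    ‖A - A'‖ ≤ ‖(A - B) - (A' - B')‖ := by
  -- Both `B` and `B'` lie below `A` and `A'`, so A - A' annihilates them.
  have h1 : (A - A') * ((A - B) - (A' - B')) = A - A' := by
    have : (A - B) - (A' - B') = (A - A') - (B - B') := by abel
    rw [this, mul_sub, hX.isIdempotentElem.eq, sub_mul, mul_sub, mul_sub, hAB, hAB', hA'B, hA'B',
      sub_self, sub_zero]
  calc ‖A - A'‖ = ‖(A - A') * ((A - B) - (A' - B'))‖ := by rw [h1]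
    _ ≤ ‖A - A'‖ * ‖(A - B) - (A' - B')‖ := norm_mul_le _ _
    _ ≤ 1 * ‖(A - B) - (A' - B')‖ := by
        gcongr
        exact hX.norm_le
    _ = _ := one_mul _

/-- If `χ_{(a, b]}` is norm continuous along a family, then so is `χ_{(a, ∞)}`. -/
theorem IsCompactFamily.continuousOn_spectralProjIoi {P : H →L[ℂ] H} {γ : ℝ → (H →L[ℂ] H)}
    {s : Set ℝ} {a b : ℝ} (h : IsCompactFamily P γ s) (ha : a ∈ Set.Ioo (-1 : ℝ) 1)
    (hb : b ∈ Set.Ioo (-1 : ℝ) 1) (hab : a < b)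
    (hcont : ContinuousOn (fun t => spectralProjIoc (γ t) a b) s) :
    ContinuousOn (fun t => spectralProjIoi (γ t) a) s := by
  intro t ht
  obtain ⟨εa, hεa, hgapa⟩ := (h.isolatedIn ha ht).exists_gap
  obtain ⟨εb, hεb, hgapb⟩ := (h.isolatedIn hb ht).exists_gap
  -- The thresholds may be spectral values at `t`, so both are shifted up into a gap. The bound b -
  -- a keeps a ≤ a + ε ≤ b ≤ b + ε, and 1 - b keeps everything in (-1, 1).
  obtain ⟨ε, hε, hε'⟩ : ∃ ε, 0 < ε ∧ ε < min (min εa εb) (min (b - a) (1 - b)) :=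
    exists_between (by simp [hεa, hεb, hab, hb.2])
  simp only [lt_min_iff] at hε'
  obtain ⟨⟨hea, heb⟩, hba, hb1⟩ := hε'
  obtain ⟨hna, ha'⟩ := hgapa ε ⟨hε, hea⟩
  obtain ⟨hnb, hb'⟩ := hgapb ε ⟨hε, heb⟩
  have haε : a + ε ∈ Set.Ioo (-1 : ℝ) 1 := ⟨by linarith [ha.1], by linarith [hb.2]⟩
  have hbε : b + ε ∈ Set.Ioo (-1 : ℝ) 1 := ⟨by linarith [hb.1], by linarith [hb.2]⟩
  have hAt := spectralProjIoi_congr (h.isolatedIn ha ht) (h.isolatedIn haε ht) ha'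
  have hBt := spectralProjIoi_congr (h.isolatedIn hb ht) (h.isolatedIn hbε ht) hb'
  have hcA := continuousWithinAt_spectralProjIoi ht (h.continuousOn t ht) h.selfAdjoint hna
  have hcB := continuousWithinAt_spectralProjIoi ht (h.continuousOn t ht) h.selfAdjoint hnb
  -- Both differences are continuous at `t` and agree there. Their distance dominates the norm of
  -- χ_{(a, a+ε]}, which therefore tends to zero, so χ_{(a,∞)} inherits the continuity of
  -- χ_{(a+ε,∞)}.
  have hlim : Tendsto (fun r => ‖spectralProjIoc (γ r) a b
      - (spectralProjIoi (γ r) (a + ε) - spectralProjIoi (γ r) (b + ε))‖) (𝓝[s] t) (𝓝 0) := by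
    have h1 := ((hcont t ht).sub (hcA.sub hcB)).norm
    have h2 : ‖spectralProjIoc (γ t) a b
        - (spectralProjIoi (γ t) (a + ε) - spectralProjIoi (γ t) (b + ε))‖ = 0 := by
      rw [spectralProjIoc_eq_sub, hAt, hBt, sub_self, norm_zero]
    rw [← h2]
    exact h1
  have hX : Tendsto (fun r => spectralProjIoi (γ r) a - spectralProjIoi (γ r) (a + ε))
      (𝓝[s] t) (𝓝 0) := by
    refine squeeze_zero_norm' ?_ hlim
    filter_upwards [self_mem_nhdsWithin] with r hr
    rw [spectralProjIoc_eq_sub]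
    have ia := h.isolatedIn ha hr
    have ib := h.isolatedIn hb hr
    have iaε := h.isolatedIn haε hr
    have ibε := h.isolatedIn hbε hr
    exact norm_sub_le_norm_sub_sub_sub (h.isStarProjection_sub ha haε (by linarith) hr)
      (spectralProjIoi_mul ia ib hab.le) (spectralProjIoi_mul ia ibε (by linarith))
      (spectralProjIoi_mul iaε ib (by linarith)) (spectralProjIoi_mul iaε ibε (by linarith))
  have h2 := hX.add hcA
  simp only [sub_add_cancel, zero_add] at h2
  rwa [← hAt] at h2

theorem FlowPartition.s_mem {γ : ℝ → (H →L[ℂ] H)} (D : FlowPartition γ) {n : ℕ} (hn : n ≤ D.N) :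
    D.s n ∈ Set.Icc (0 : ℝ) 1 := by
  have hmono : ∀ m k, m + k ≤ D.N → D.s m ≤ D.s (m + k) := by
    intro m k
    induction k with
    | zero => simp
    | succ k ih =>
      intro hk
      exact (ih (by omega)).trans (D.s_lt (m + k) (by omega)).le
  constructor
  · have := hmono 0 n (by omega)
    rwa [D.s_zero, zero_add] at this
  · have := hmono n (D.N - n) (by omega)
    rwa [Nat.add_sub_cancel' hn, D.s_last] at this

/-- The spectral flow is the relative index of the spectral projections at the end points. -/
theorem FlowPartition.flow_eq_relativeIndex {P : H →L[ℂ] H} {γ : ℝ → (H →L[ℂ] H)}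
    (h : IsCompactFamily P γ (Set.Icc 0 1)) (D : FlowPartition γ) :
    D.flow = relativeIndex (spectralProjIoi (γ 1) 0) (spectralProjIoi (γ 0) 0) := by
  have h0 : (0 : ℝ) ∈ Set.Ioo (-1 : ℝ) 1 := by norm_num
  -- Each rank is the relative index of E_a and E_0 at one end. The relative index of E_a between
  -- the two ends vanishes, so additivity leaves that of E_0, with the later end first.
  have hstep : ∀ n < D.N, (rk (spectralProjIoc (γ (D.s n)) (D.a n) 0) : ℤ)
      - (rk (spectralProjIoc (γ (D.s (n + 1))) (D.a n) 0) : ℤ)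
      = relativeIndex (spectralProjIoi (γ (D.s (n + 1))) 0) (spectralProjIoi (γ (D.s n)) 0) := by
    intro n hn
    obtain ⟨ha, ha'⟩ := D.a_mem n hn
    obtain ⟨hb, hb'⟩ := D.b_mem n hn
    have haI : D.a n ∈ Set.Ioo (-1 : ℝ) 1 := ⟨ha, by linarith⟩
    have hbI : D.b n ∈ Set.Ioo (-1 : ℝ) 1 := ⟨by linarith, hb'⟩
    have hs := D.s_mem hn.le
    have hs' := D.s_mem (Nat.succ_le_of_lt hn)
    have hsub : Set.Icc (D.s n) (D.s (n + 1)) ⊆ Set.Icc 0 1 := Set.Icc_subset_Icc hs.1 hs'.2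
    have hcont := (h.mono hsub).continuousOn_spectralProjIoi haI hbI (by linarith)
      (D.continuousOn n hn)
    have hle := (D.s_lt n hn).le
    have hzero := (h.mono hsub).relativeIndex_eq_zero isPreconnected_Icc haI hcont
      (Set.left_mem_Icc.mpr hle) (Set.right_mem_Icc.mpr hle)
    rw [h.rk_spectralProjIoc haI h0 ha'.le hs, h.rk_spectralProjIoc haI h0 ha'.le hs',
      h.relativeIndex_trans haI haI h0 hs hs' hs, hzero,
      h.relativeIndex_trans haI h0 h0 hs' hs' hs]
    ring
  have hsum : ∀ m ≤ D.N, ∑ n ∈ Finset.range m,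
      ((rk (spectralProjIoc (γ (D.s n)) (D.a n) 0) : ℤ)
        - (rk (spectralProjIoc (γ (D.s (n + 1))) (D.a n) 0) : ℤ))
      = relativeIndex (spectralProjIoi (γ (D.s m)) 0) (spectralProjIoi (γ 0) 0) := by
    intro m
    induction m with
    | zero =>
      intro _
      rw [Finset.sum_range_zero, D.s_zero,
        relativeIndex_self (isStarProjection_spectralProjIoi _ _)]
    | succ m ih =>
      intro hm
      rw [Finset.sum_range_succ, ih (by omega), hstep m (by omega),
        h.relativeIndex_trans h0 h0 h0 (D.s_mem hm) (D.s_mem (n := m) (by omega))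
          (Set.left_mem_Icc.mpr zero_le_one)]
      ring
  rw [FlowPartition.flow, hsum D.N le_rfl, D.s_last]

/-- As 0 is isolated in the spectrum at `t`, some ±ε with ε < 1 avoid it; upper hemicontinuity of
the spectrum keeps them avoided nearby. -/
theorem IsCompactFamily.exists_local_gap {P : H →L[ℂ] H} {γ : ℝ → (H →L[ℂ] H)} {s : Set ℝ}
    (h : IsCompactFamily P γ s) {t : ℝ} (ht : t ∈ s) :
    ∃ ρ > 0, ∃ a ∈ Set.Ioo (-1 : ℝ) 0, ∃ b ∈ Set.Ioo (0 : ℝ) 1, ∀ r ∈ Metric.ball t ρ ∩ s,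
      a ∉ spectrum ℝ (γ r) ∧ b ∉ spectrum ℝ (γ r) := by
  obtain ⟨δ, hδ, hsep⟩ := h.isolatedIn (c := 0) (by norm_num) ht
  obtain ⟨ε, hε, hε'⟩ : ∃ ε, 0 < ε ∧ ε < min δ 1 := exists_between (by simp [hδ])
  rw [lt_min_iff] at hε'
  have hna : -ε ∉ spectrum ℝ (γ t) := fun hmem => by
    have := hsep _ hmem (by linarith)
    rw [sub_zero, abs_neg, abs_of_pos hε] at this
    linarith
  have hnb : ε ∉ spectrum ℝ (γ t) := fun hmem => by
    have := hsep _ hmem hε.ne'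
    rw [sub_zero, abs_of_pos hε] at this
    linarith
  have hopen : IsOpen ({-ε, ε}ᶜ : Set ℝ) := (Set.toFinite _).isClosed.isOpen_compl
  have hmem : ({-ε, ε}ᶜ : Set ℝ) ∈ 𝓝ˢ (spectrum ℝ (γ t)) := by
    refine hopen.mem_nhdsSet.mpr fun x hx hx' => ?_
    rcases hx' with rfl | rfl
    · exact hna hx
    · exact hnb hx
  obtain ⟨ρ, hρ, hball⟩ := Metric.mem_nhdsWithin_iff.mp
    (eventually_spectrum_subset (h.continuousOn t ht) hmem)
  refine ⟨ρ, hρ, -ε, ⟨by linarith, by linarith⟩, ε, ⟨hε, hε'.2⟩, fun r hr => ?_⟩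
  have hsub : spectrum ℝ (γ r) ⊆ {-ε, ε}ᶜ := hball hr
  exact ⟨fun hmem => hsub hmem (by simp), fun hmem => hsub hmem (by simp)⟩

theorem IsCompactFamily.nonempty_flowPartition {P : H →L[ℂ] H} {γ : ℝ → (H →L[ℂ] H)}
    (h : IsCompactFamily P γ (Set.Icc 0 1)) : Nonempty (FlowPartition γ) := by
  choose! ρ hρ a ha b hb hab using fun t => h.exists_local_gap (t := t)
  -- A uniform mesh finer than the Lebesgue number puts each partition interval inside one ball of
  -- the local gap cover, so one pair of thresholds serves it.
  obtain ⟨δ, hδ, hleb⟩ := lebesgue_number_lemma_of_metric (isCompact_Icc (a := (0 : ℝ)) (b := 1))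
    (c := fun t : Set.Icc (0 : ℝ) 1 => Metric.ball (t : ℝ) (ρ t)) (fun _ => Metric.isOpen_ball)
    (fun t ht => Set.mem_iUnion.mpr ⟨⟨t, ht⟩, Metric.mem_ball_self (hρ t ht)⟩)
  obtain ⟨n, hn⟩ := exists_nat_one_div_lt hδ
  have hN : (0 : ℝ) < n + 1 := by positivity
  let s : ℕ → ℝ := fun k => k / (n + 1)
  have hs_succ : ∀ k, s (k + 1) = s k + 1 / (n + 1) := fun k => by
    simp only [s]
    push_cast
    ring
  have hs_mem : ∀ k ≤ n + 1, s k ∈ Set.Icc (0 : ℝ) 1 := fun k hk =>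
    ⟨by positivity, by
      rw [div_le_one hN]
      exact_mod_cast hk⟩
  have hloc : ∀ k < n + 1, ∃ t ∈ Set.Icc (0 : ℝ) 1, ∀ r ∈ Set.Icc (s k) (s (k + 1)),
      r ∈ Metric.ball t (ρ t) ∩ Set.Icc 0 1 := by
    intro k hk
    obtain ⟨t, ht⟩ := hleb (s k) (hs_mem k hk.le)
    refine ⟨t, t.2, fun r hr => ⟨ht ?_, ?_⟩⟩
    · rw [Metric.mem_ball, Real.dist_eq, abs_of_nonneg (by linarith [hr.1])]
      have := hr.2
      rw [hs_succ] at this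
      linarith
    · exact ⟨(hs_mem k hk.le).1.trans hr.1, hr.2.trans (hs_mem (k + 1) hk).2⟩
  choose! τ hτ hτ' using hloc
  have hsub : ∀ k < n + 1, Set.Icc (s k) (s (k + 1)) ⊆ Set.Icc 0 1 :=
    fun k hk r hr => (hτ' k hk r hr).2
  have haI : ∀ k < n + 1, a (τ k) ∈ Set.Ioo (-1 : ℝ) 1 := fun k hk =>
    ⟨(ha _ (hτ k hk)).1, by linarith [(ha _ (hτ k hk)).2]⟩
  have hbI : ∀ k < n + 1, b (τ k) ∈ Set.Ioo (-1 : ℝ) 1 := fun k hk =>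
    ⟨by linarith [(hb _ (hτ k hk)).1], (hb _ (hτ k hk)).2⟩
  have hle : ∀ k < n + 1, a (τ k) ≤ b (τ k) := fun k hk =>
    ((ha _ (hτ k hk)).2.trans (hb _ (hτ k hk)).1).le
  have hca : ∀ k < n + 1, ContinuousOn (fun t => spectralProjIoi (γ t) (a (τ k)))
      (Set.Icc (s k) (s (k + 1))) := fun k hk r hr =>
    continuousWithinAt_spectralProjIoi hr ((h.mono (hsub k hk)).continuousOn r hr)
      (h.mono (hsub k hk)).selfAdjoint (hab _ (hτ k hk) r (hτ' k hk r hr)).1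
  have hcb : ∀ k < n + 1, ContinuousOn (fun t => spectralProjIoi (γ t) (b (τ k)))
      (Set.Icc (s k) (s (k + 1))) := fun k hk r hr =>
    continuousWithinAt_spectralProjIoi hr ((h.mono (hsub k hk)).continuousOn r hr)
      (h.mono (hsub k hk)).selfAdjoint (hab _ (hτ k hk) r (hτ' k hk r hr)).2
  refine ⟨{ N := n + 1, s := s, a := fun k => a (τ k), b := fun k => b (τ k),
            s_zero := by simp [s], s_last := ?_, s_lt := ?_,
            a_mem := fun k hk => ha _ (hτ k hk), b_mem := fun k hk => hb _ (hτ k hk),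
            continuousOn := ?_, finite_rank := ?_, rank_const := ?_ }⟩
  · simp only [s]
    push_cast
    exact div_self hN.ne'
  · intro k _
    rw [hs_succ]
    have : (0 : ℝ) < 1 / (n + 1) := by positivity
    linarith
  · intro k hk
    simp only [spectralProjIoc_eq_sub]
    exact (hca k hk).sub (hcb k hk)
  · intro k hk t ht
    exact h.finiteDimensional_range (haI k hk) (hbI k hk) (hle k hk) (hsub k hk ht)
  · intro k hk t ht t' ht'
    -- Rank constancy: the rank is the relative index of E_a and E_b, and neither projection changes
    -- its relative index class along the interval.
    have hF := h.mono (hsub k hk)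
    have h1 := hF.relativeIndex_eq_zero isPreconnected_Icc (haI k hk) (hca k hk) ht ht'
    have h2 := hF.relativeIndex_eq_zero isPreconnected_Icc (hbI k hk) (hcb k hk) ht' ht
    have h3 := hF.relativeIndex_trans (haI k hk) (haI k hk) (hbI k hk) ht ht' ht
    have h4 := hF.relativeIndex_trans (haI k hk) (hbI k hk) (hbI k hk) ht' ht' ht
    have h5 := hF.rk_spectralProjIoc (haI k hk) (hbI k hk) (hle k hk) ht
    have h6 := hF.rk_spectralProjIoc (haI k hk) (hbI k hk) (hle k hk) ht'
    omega

end Flow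

/-! ### The even pairing as a spectral flow -/

section Pairing

variable {H : Type*} [NormedAddCommGroup H] [InnerProductSpace ℂ H] [CompleteSpace H]
  {P F : H →L[ℂ] H}

theorem isStarProjection_conj (hF : F ∈ unitary (H →L[ℂ] H)) (hP : IsStarProjection P) :
    IsStarProjection (star F * P * F) := by
  refine ⟨?_, hP.isSelfAdjoint.conjugate' F⟩
  calc star F * P * F * (star F * P * F) = star F * P * (F * star F) * P * F := by noncomm_ring
    _ = star F * (P * P) * F := by rw [Unitary.mul_star_self_of_mem hF]; noncomm_ring
    _ = star F * P * F := by rw [hP.isIdempotentElem.eq]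

theorem isCompactOperator_conj_sub (hF : F ∈ unitary (H →L[ℂ] H))
    (h : IsCompactOperator (F * P - P * F : H →L[ℂ] H)) :
    IsCompactOperator (star F * P * F - P : H →L[ℂ] H) := by
  have h1 : star F * P * F - P = star F ∘L (-(F * P - P * F)) := by
    rw [← ContinuousLinearMap.mul_def, neg_sub, mul_sub, ← mul_assoc, ← mul_assoc,
      Unitary.star_mul_self_of_mem hF, one_mul]
  have h2 : IsCompactOperator (-(F * P - P * F) : H →L[ℂ] H) := h.neg
  rw [h1]
  exact h2.clm_comp (star F)

/-- A unitary `F` as a map from the range of `F* P F` to the range of `P`. -/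
def conjRange (hF : F ∈ unitary (H →L[ℂ] H)) : (star F * P * F).range ≃ₗ[ℂ] P.range where
  toFun := fun y => ⟨F (y : H), by
    obtain ⟨_, x, rfl⟩ := y
    refine ⟨F x, ?_⟩
    change P (F x) = (F * (star F * P * F)) x
    rw [← mul_assoc, ← mul_assoc, Unitary.mul_star_self_of_mem hF, one_mul]
    rfl⟩
  invFun := fun y => ⟨star F (y : H), by
    obtain ⟨_, x, rfl⟩ := y
    refine ⟨star F x, ?_⟩
    change (star F * P * F * star F) x = (star F * P) x
    rw [mul_assoc _ F, Unitary.mul_star_self_of_mem hF, mul_one]⟩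
  left_inv := fun y => Subtype.ext (by
    change (star F * F) (y : H) = y
    rw [Unitary.star_mul_self_of_mem hF]
    rfl)
  right_inv := fun y => Subtype.ext (by
    change (F * star F) (y : H) = y
    rw [Unitary.mul_star_self_of_mem hF]
    rfl)
  map_add' := fun x y => Subtype.ext (map_add F (x : H) y)
  map_smul' := fun c x => Subtype.ext (map_smul F c (x : H))

/-- `conjRange` as a continuous linear equivalence. -/
def conjRangeL (hF : F ∈ unitary (H →L[ℂ] H)) : (star F * P * F).range ≃L[ℂ] P.range where
  toLinearEquiv := conjRange hF
  continuous_toFun := by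
    refine Continuous.subtype_mk ?_ _
    exact F.continuous.comp continuous_subtype_val
  continuous_invFun := by
    refine Continuous.subtype_mk ?_ _
    exact (star F).continuous.comp continuous_subtype_val

/-- This is P F = F (F* P F), read on Ran P. -/
theorem compression_eq (hF : F ∈ unitary (H →L[ℂ] H)) (hP : IsStarProjection P) :
    compression P F = (conjRangeL (P := P) hF : (star F * P * F).range →L[ℂ] P.range)
      ∘L cut P (star F * P * F) := by
  ext x
  change P (F (P x)) = (F * (star F * P * F)) x
  rw [apply_of_mem_range hP, ← mul_assoc, ← mul_assoc, Unitary.mul_star_self_of_mem hF, one_mul]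
  rfl

theorem isFredholm_compression (hF : F ∈ unitary (H →L[ℂ] H)) (hP : IsStarProjection P)
    (h : IsCompactOperator (F * P - P * F : H →L[ℂ] H)) : (compression P F).IsFredholm := by
  have hP' := isStarProjection_conj hF hP
  have := completeSpace_range hP
  have := completeSpace_range hP'
  have hpar := isParametrix_cut hP hP'
    (isCompactOperator_sub_comm (isCompactOperator_conj_sub hF h))
  obtain ⟨v, hv⟩ := hpar.isFredholm.exists_isQuasiInverse
  rw [compression_eq hF hP]
  exact ContinuousLinearMap.IsFredholm.of_isQuasiInverse
    (v := v ∘L ((conjRangeL (P := P) hF).symm : P.range →L[ℂ] (star F * P * F).range))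
    (hv.comp (conjRangeL (P := P) hF).toLinearEquiv.isQuasiInverse)

theorem evenPairing_eq_relativeIndex (hF : F ∈ unitary (H →L[ℂ] H)) (hP : IsStarProjection P)
    (h : IsCompactOperator (F * P - P * F : H →L[ℂ] H)) :
    evenPairing F hP = relativeIndex P (star F * P * F) := by
  have hP' := isStarProjection_conj hF hP
  have := completeSpace_range hP
  have := completeSpace_range hP'
  have hpar := isParametrix_cut hP hP'
    (isCompactOperator_sub_comm (isCompactOperator_conj_sub hF h))
  have hbij := (conjRangeL (P := P) hF).bijective
  have h1 := linearIndex_comp (FiniteKerCoker.of_bijective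
    (f := (conjRangeL (P := P) hF).toLinearEquiv.toLinearMap) hbij)
    (finiteKerCoker_of_isFredholm hpar.isFredholm)
  rw [linearIndex_of_bijective
    (f := (conjRangeL (P := P) hF).toLinearEquiv.toLinearMap) hbij, zero_add] at h1
  rw [evenPairing, fredholmIndex_eq_linearIndex (isFredholm_compression hF hP h),
    compression_eq hF hP]
  exact h1

theorem conj_two_mul_sub_one (hF : F ∈ unitary (H →L[ℂ] H)) :
    star F * (2 * P - 1) * F = 2 * (star F * P * F) - 1 := by
  rw [mul_sub, sub_mul, mul_one, Unitary.star_mul_self_of_mem hF, two_mul, two_mul, mul_add,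
    add_mul]

theorem isFredholm_of_sub_two_mul_sub_one {T : H →L[ℂ] H} (hP : IsStarProjection P)
    (h : IsCompactOperator (T - (2 * P - 1) : H →L[ℂ] H)) : T.IsFredholm := by
  have hsq : (2 * P - 1) * (2 * P - 1) = 1 := by
    simpa using sub_mul_add_of_isStarProjection hP 0
  have hpar : IsParametrix (2 * P - 1) (2 * P - 1) := by
    have : IsCompactOperator
        ((2 * P - 1 : H →L[ℂ] H) ∘L (2 * P - 1) - ContinuousLinearMap.id ℂ H : H →L[ℂ] H) := by
      rw [← ContinuousLinearMap.mul_def, hsq, ContinuousLinearMap.one_def, sub_self]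
      exact isCompactOperator_zero
    exact ⟨this, this⟩
  exact (hpar.congr h).isFredholm

theorem theta_nonempty (hF : F ∈ unitary (H →L[ℂ] H)) (hP : IsStarProjection P)
    (h : IsCompactOperator (F * P - P * F : H →L[ℂ] H)) : (Theta (2 * P - 1) F).Nonempty := by
  have hP' := isStarProjection_conj hF hP
  have hK := isCompactOperator_conj_sub hF h
  -- The straight line between the end points; the factor 2 is that of 2P - 1.
  let γ : ℝ → (H →L[ℂ] H) := fun s => (2 * P - 1) + (2 * s) • (star F * P * F - P)
  have hcomp : ∀ s : ℝ, IsCompactOperator (γ s - (2 * P - 1) : H →L[ℂ] H) := fun s => by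
    have h1 : γ s - (2 * P - 1) = (2 * s) • (star F * P * F - P) := add_sub_cancel_left _ _
    rw [h1]
    exact hK.smul (2 * s)
  have hcont : Continuous γ := by fun_prop
  have hsa : ∀ s, IsSelfAdjoint (γ s) := fun s =>
    (isSelfAdjoint_two_mul_sub_one hP).add
      ((IsSelfAdjoint.all (2 * s)).smul (hP'.isSelfAdjoint.sub hP.isSelfAdjoint))
  have hγ0 : γ 0 = 2 * P - 1 := by simp [γ]
  have hγ1 : γ 1 = star F * (2 * P - 1) * F := by
    have h1 : γ 1 = 2 * P - 1 + ((star F * P * F - P) + (star F * P * F - P)) := by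
      simp only [γ]
      rw [mul_one, two_smul]
    rw [h1, conj_two_mul_sub_one hF, two_mul, two_mul]
    abel
  exact ⟨γ, ⟨hcont.continuousOn, fun s _ => hsa s,
    fun s _ => isFredholm_of_sub_two_mul_sub_one hP (hcomp s)⟩, hγ0, fun s _ => hcomp s, hγ1⟩

theorem hasPairSpectralFlow (hF : F ∈ unitary (H →L[ℂ] H)) (hP : IsStarProjection P)
    (h : IsCompactOperator (F * P - P * F : H →L[ℂ] H)) :
    HasPairSpectralFlow (2 * P - 1) F (relativeIndex (star F * P * F) P) := by
  refine ⟨theta_nonempty hF hP h, ?_⟩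
  rintro γ ⟨hγ, hγ0, hγK, hγ1⟩
  have hfam : IsCompactFamily P γ (Set.Icc 0 1) :=
    ⟨hP, hγ.continuousOn, hγ.selfAdjoint, hγK⟩
  have h0 : (0 : ℝ) ∈ Set.Ioo (-1 : ℝ) 1 := by norm_num
  refine ⟨hγ, hfam.nonempty_flowPartition, fun D => ?_⟩
  rw [D.flow_eq_relativeIndex hfam, hγ0, hγ1, conj_two_mul_sub_one hF,
    spectralProjIoi_two_mul_sub_one hP h0,
    spectralProjIoi_two_mul_sub_one (isStarProjection_conj hF hP) h0]

/-- A path and a partition exist, so the value is pinned down by an actual sum; this is what makes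
the choice in `pairSpectralFlow` harmless. -/
theorem HasPairSpectralFlow.unique {G U : H →L[ℂ] H} {m m' : ℤ} (h : HasPairSpectralFlow G U m)
    (h' : HasPairSpectralFlow G U m') : m = m' := by
  obtain ⟨γ, hγ⟩ := h.1
  obtain ⟨D⟩ := (h.2 γ hγ).exists_partition
  rw [← (h.2 γ hγ).flow_eq D, (h'.2 γ hγ).flow_eq D]

theorem HasPairSpectralFlow.pairSpectralFlow_eq {G U : H →L[ℂ] H} {m : ℤ}
    (h : HasPairSpectralFlow G U m) : pairSpectralFlow G U = m :=
  (Classical.epsilon_spec (p := HasPairSpectralFlow G U) ⟨m, h⟩).unique h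

end Pairing

end

end SpectralFlowPairing

theorem mainTheorem6 {H : Type*} [NormedAddCommGroup H] [InnerProductSpace ℂ H] [CompleteSpace H]
    [TopologicalSpace.SeparableSpace H]
    (A : NonUnitalStarSubalgebra ℂ (H →L[ℂ] H)) (hA : IsClosed (A : Set (H →L[ℂ] H)))
    (F : H →L[ℂ] H) (hF : SpectralFlowPairing.IsEvenFredholmModule A F)
    (P : H →L[ℂ] H) (hPA : P ∈ A) (hP : IsStarProjection P) :
    (SpectralFlowPairing.compression P F).IsFredholm ∧
    (∃ m : ℤ, SpectralFlowPairing.HasPairSpectralFlow (2 * P - 1) F m) ∧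
    SpectralFlowPairing.evenPairing F hP =
      -SpectralFlowPairing.pairSpectralFlow (2 * P - 1) F := by
  have hK := hF.compact_commutator P hPA
  have hflow := SpectralFlowPairing.hasPairSpectralFlow hF.unitary hP hK
  refine ⟨SpectralFlowPairing.isFredholm_compression hF.unitary hP hK, ⟨_, hflow⟩, ?_⟩
  rw [hflow.pairSpectralFlow_eq, SpectralFlowPairing.evenPairing_eq_relativeIndex hF.unitary hP hK,
    SpectralFlowPairing.relativeIndex_symm
      (SpectralFlowPairing.isStarProjection_conj hF.unitary hP) hP
      (SpectralFlowPairing.isCompactOperator_conj_sub hF.unitary hK)]
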